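/- Let $n\ge 2$ and let $\Omega_0\subset\mathbb R^n$ be an open, bounded, connected set with Lipschitz boundary and $0\in\Omega_0$. Let $B_r$ be the open ball of radius $r$ centred at the origin and, for $r>0$ with $\overline B_r\subset\Omega_0$, put $\Omega_r=\Omega_0\setminus\overline B_r$. Let $H^1_{\partial B_r}(\Omega_r)$ be the closure in $H^1(\Omega_r)$ of the restrictions to $\Omega_r$ of functions in $C_c^\infty(\mathbb R^n)$ whose support does not meet $\partial B_r$. The first Steklov–Dirichlet eigenvalue of $\Omega_r$ is $$\sigma_1(\Omega_r)=\inf\left\{\frac{\int_{\Omega_r}|\nabla v|^2\,dx}{\int_{\partial\Omega_0}v^2\,d\mathcal H^{n-1}}\;:\; v\in H^1_{\partial B_r}(\Omega_r),\ \int_{\partial\Omega_0}v^2\,d\mathcal H^{n-1}\neq0\right\},$$ where values on $\partial\Omega_0$ are understood in the sense of traces. An eigenfunction corresponding to $\sigma_1(\Omega_r)$ is a nonzero $u\in H^1_{\partial B_r}(\Omega_r)$ such that $$\int_{\Omega_r}\nabla\varphi\cdot\nabla u\,dx=\sigma_1(\Omega_r)\int_{\partial\Omega_0}\varphi u\,d\mathcal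 H^{n-1}\qquad\text{for all }\varphi\in H^1_{\partial B_r}(\Omega_r).$$ Let $u_1^r$ denote a positive eigenfunction corresponding to $\sigma_1(\Omega_r)$ with $\|u_1^r\|_{L^2(\partial\Omega_0)}=1$, extended by zero in $\overline B_r$, and let $P(\Omega_0)=\mathcal H^{n-1}(\partial\Omega_0)$. Then every such $u_1^r$ belongs to $H^1(\Omega_0)$, and, as $r\to0^+$, $$u_1^r\to\frac1{\sqrt{P(\Omega_0)}}\quad\text{in }H^1(\Omega_0),$$ that is, for every $\varepsilon>0$ there is $\delta>0$ such that $\left\|u_1^r-P(\Omega_0)^{-1/2}\right\|_{H^1(\Omega_0)}<\varepsilon$ for all $0<r<\delta$ with $\overline B_r\subset\Omega_0$ and all such $u_1^r$. Moreover, $\sigma_1(\Omega_r)\to0$ as $r\to0^+$. -/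

import Mathlib

open MeasureTheory Set Filter Topology
open scoped ENNReal NNReal ContDiff Gradient

namespace SteklovDirichlet

noncomputable section

/-- Lipschitz boundary: near each boundary point, in suitable orthonormal coordinates,
`Ω` is the strict subgraph of a Lipschitz function `g`. Here `e` is the "vertical" unit vector and
`x - ⟪x, e⟫ e` is the "horizontal" part of `x`; only the values of `g` on the hyperplane
orthogonal to `e` matter. -/
def HasLipschitzBoundary {n : ℕ} (Ω : Set (EuclideanSpace ℝ (Fin n))) : Prop :=
  ∀ p ∈ frontier Ω, ∃ e : EuclideanSpace ℝ (Fin n), ‖e‖ = 1 ∧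
    ∃ (K : ℝ≥0) (g : EuclideanSpace ℝ (Fin n) → ℝ), LipschitzWith K g ∧
      ∃ δ > 0, ∀ x ∈ Metric.ball p δ, (x ∈ Ω ↔ inner ℝ x e < g (x - inner ℝ x e • e))

/-- `C_c^∞(ℝⁿ)`. -/
def IsTestFunction {n : ℕ} (φ : EuclideanSpace ℝ (Fin n) → ℝ) : Prop :=
  ContDiff ℝ ∞ φ ∧ HasCompactSupport φ

/-- `u ∈ L²(Ω)`, and `G ∈ L²(Ω; ℝⁿ)` is a weak gradient of `u` in the open set `Ω`. Functions are
defined on all of `ℝⁿ`, only their values in `Ω` (up to null sets) matter. -/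
structure HasL2WeakGradient {n : ℕ} (Ω : Set (EuclideanSpace ℝ (Fin n)))
    (u : EuclideanSpace ℝ (Fin n) → ℝ)
    (G : EuclideanSpace ℝ (Fin n) → EuclideanSpace ℝ (Fin n)) : Prop where
  memLp : MemLp u 2 (volume.restrict Ω)
  memLp_grad : MemLp G 2 (volume.restrict Ω)
  integral_eq : ∀ φ : EuclideanSpace ℝ (Fin n) → ℝ, IsTestFunction φ → tsupport φ ⊆ Ω →
    ∫ x in Ω, u x • ∇ φ x = - ∫ x in Ω, φ x • G x

/-- `u ∈ H¹(Ω)`. -/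
def MemH1 {n : ℕ} (Ω : Set (EuclideanSpace ℝ (Fin n)))
    (u : EuclideanSpace ℝ (Fin n) → ℝ) : Prop :=
  ∃ G, HasL2WeakGradient Ω u G

open Classical in
/-- The weak gradient of `u ∈ H¹(Ω)` (unique up to null sets). -/
def weakGrad {n : ℕ} (Ω : Set (EuclideanSpace ℝ (Fin n)))
    (u : EuclideanSpace ℝ (Fin n) → ℝ) : EuclideanSpace ℝ (Fin n) → EuclideanSpace ℝ (Fin n) :=
  if h : MemH1 Ω u then h.choose else 0

/-- `‖u‖_{H¹(Ω)} = (‖u‖²_{L²(Ω)} + ‖∇u‖²_{L²(Ω)})^{1/2}`, used for `u ∈ H¹(Ω)`. -/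
def h1Norm {n : ℕ} (Ω : Set (EuclideanSpace ℝ (Fin n)))
    (u : EuclideanSpace ℝ (Fin n) → ℝ) : ℝ≥0∞ :=
  (eLpNorm u 2 (volume.restrict Ω) ^ 2 +
    eLpNorm (weakGrad Ω u) 2 (volume.restrict Ω) ^ 2) ^ (1 / 2 : ℝ)

/-- The `(n-1)`-dimensional Hausdorff measure (normalized to be the surface measure)
on `Γ ⊆ ℝⁿ`. -/
def surfaceMeasure {n : ℕ} (Γ : Set (EuclideanSpace ℝ (Fin n))) :
    Measure (EuclideanSpace ℝ (Fin n)) :=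
  (μHE[n - 1]).restrict Γ

/-- The perimeter `P(Ω) = H^{n-1}(∂Ω)`. -/
def perimeter {n : ℕ} (Ω : Set (EuclideanSpace ℝ (Fin n))) : ℝ :=
  (surfaceMeasure (frontier Ω) univ).toReal

/-- `H¹_Γ(Ω)`: the closure in `H¹(Ω)` of the restrictions to `Ω` of the functions of
`C_c^∞(ℝⁿ)` whose support does not meet `Γ`. -/
def MemH1Vanishing {n : ℕ} (Ω Γ : Set (EuclideanSpace ℝ (Fin n)))
    (u : EuclideanSpace ℝ (Fin n) → ℝ) : Prop :=
  MemH1 Ω u ∧ ∀ ε : ℝ≥0∞, 0 < ε → ∃ φ : EuclideanSpace ℝ (Fin n) → ℝ,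
    IsTestFunction φ ∧ Disjoint (tsupport φ) Γ ∧ h1Norm Ω (u - φ) < ε

/-- `T ∈ L²(Γ)` is the trace of `u ∈ H¹(Ω)` on the part `Γ` of the boundary of `Ω`: the pair
`(u, T)` is a limit in `H¹(Ω) × L²(Γ)` of pairs `(φ|_Ω, φ|_Γ)` with `φ ∈ C_c^∞(ℝⁿ)`. -/
def IsTrace {n : ℕ} (Ω Γ : Set (EuclideanSpace ℝ (Fin n)))
    (u T : EuclideanSpace ℝ (Fin n) → ℝ) : Prop :=
  MemH1 Ω u ∧ MemLp T 2 (surfaceMeasure Γ) ∧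
    ∀ ε : ℝ≥0∞, 0 < ε → ∃ φ : EuclideanSpace ℝ (Fin n) → ℝ, IsTestFunction φ ∧
      h1Norm Ω (u - φ) < ε ∧ eLpNorm (T - φ) 2 (surfaceMeasure Γ) < ε

open Classical in
/-- The trace of `u` on `Γ` (unique up to null sets of `Γ`). -/
def trace {n : ℕ} (Ω Γ : Set (EuclideanSpace ℝ (Fin n)))
    (u : EuclideanSpace ℝ (Fin n) → ℝ) : EuclideanSpace ℝ (Fin n) → ℝ :=
  if h : ∃ T, IsTrace Ω Γ u T then h.choose else 0

/-- The perforated domain `Ω_r = Ω₀ \ closure B_r`. -/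
def perforated {n : ℕ} (Ω₀ : Set (EuclideanSpace ℝ (Fin n))) (r : ℝ) :
    Set (EuclideanSpace ℝ (Fin n)) :=
  Ω₀ \ Metric.closedBall 0 r

/-- `v ∈ H¹_{∂B_r}(Ω_r)`. -/
def MemH1Hole {n : ℕ} (Ω₀ : Set (EuclideanSpace ℝ (Fin n))) (r : ℝ)
    (v : EuclideanSpace ℝ (Fin n) → ℝ) : Prop :=
  MemH1Vanishing (perforated Ω₀ r) (Metric.sphere 0 r) v

/-- The trace on the outer boundary `∂Ω₀` of a function on `Ω_r`. -/
def outerTrace {n : ℕ} (Ω₀ : Set (EuclideanSpace ℝ (Fin n))) (r : ℝ)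
    (v : EuclideanSpace ℝ (Fin n) → ℝ) : EuclideanSpace ℝ (Fin n) → ℝ :=
  trace (perforated Ω₀ r) (frontier Ω₀) v

/-- The Dirichlet form `∫_{Ω_r} ∇v · ∇w dx`. -/
def dirichletForm {n : ℕ} (Ω₀ : Set (EuclideanSpace ℝ (Fin n))) (r : ℝ)
    (v w : EuclideanSpace ℝ (Fin n) → ℝ) : ℝ :=
  ∫ x in perforated Ω₀ r, inner ℝ (weakGrad (perforated Ω₀ r) v x) (weakGrad (perforated Ω₀ r) w x)

/-- The boundary form `∫_{∂Ω₀} v w dH^{n-1}`. -/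
def boundaryForm {n : ℕ} (Ω₀ : Set (EuclideanSpace ℝ (Fin n))) (r : ℝ)
    (v w : EuclideanSpace ℝ (Fin n) → ℝ) : ℝ :=
  ∫ x, outerTrace Ω₀ r v x * outerTrace Ω₀ r w x ∂(surfaceMeasure (frontier Ω₀))

/-- The first Steklov–Dirichlet eigenvalue of `Ω_r`: the infimum of the Rayleigh quotient over
`H¹_{∂B_r}(Ω_r)` (functions with zero trace on `∂Ω₀` have quotient `+∞` and do not compete). -/
def sigma1 {n : ℕ} (Ω₀ : Set (EuclideanSpace ℝ (Fin n))) (r : ℝ) : ℝ :=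
  sInf {q : ℝ | ∃ v : EuclideanSpace ℝ (Fin n) → ℝ, MemH1Hole Ω₀ r v ∧
    boundaryForm Ω₀ r v v ≠ 0 ∧ q = dirichletForm Ω₀ r v v / boundaryForm Ω₀ r v v}

/-- `u` is an eigenfunction for the eigenvalue `σ` of the Steklov–Dirichlet problem
`Δu = 0` in `Ω_r`, `∂u/∂ν = σ u` on `∂Ω₀`, `u = 0` on `∂B_r`, in the weak sense. -/
structure IsEigenfunction {n : ℕ} (Ω₀ : Set (EuclideanSpace ℝ (Fin n))) (r σ : ℝ)
    (u : EuclideanSpace ℝ (Fin n) → ℝ) : Prop where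
  mem : MemH1Hole Ω₀ r u
  ne_zero : ¬ u =ᵐ[volume.restrict (perforated Ω₀ r)] 0
  weak_eq : ∀ φ : EuclideanSpace ℝ (Fin n) → ℝ, MemH1Hole Ω₀ r φ →
    dirichletForm Ω₀ r φ u = σ * boundaryForm Ω₀ r φ u

/-- `u` is a positive eigenfunction for `σ₁(Ω_r)` with `‖u‖_{L²(∂Ω₀)} = 1`. -/
structure IsNormalizedFirstEigenfunction {n : ℕ} (Ω₀ : Set (EuclideanSpace ℝ (Fin n))) (r : ℝ)
    (u : EuclideanSpace ℝ (Fin n) → ℝ) : Prop where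
  eigen : IsEigenfunction Ω₀ r (sigma1 Ω₀ r) u
  pos : ∀ᵐ x ∂(volume.restrict (perforated Ω₀ r)), 0 < u x
  norm_eq : eLpNorm (outerTrace Ω₀ r u) 2 (surfaceMeasure (frontier Ω₀)) = 1

/-- The extension by zero of `u : Ω_r → ℝ`. -/
def zeroExtend {n : ℕ} (Ω₀ : Set (EuclideanSpace ℝ (Fin n))) (r : ℝ)
    (u : EuclideanSpace ℝ (Fin n) → ℝ) : EuclideanSpace ℝ (Fin n) → ℝ :=
  (perforated Ω₀ r).indicator u

end

end SteklovDirichlet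

/-! A point has zero capacity in dimension at least two. Averaging cutoffs at many dyadic scales
gives a smooth function that is zero near the origin, one on the outer boundary, and of arbitrarily
small energy (`exists_cutoff`, `exists_testFunction_small_energy`). It competes in the Rayleigh
quotient for every small `r`, whence `tendsto_sigma1`.

Testing the weak equation with the eigenfunction itself shows that its Dirichlet energy equals the
eigenvalue (`IsNormalizedFirstEigenfunction.eLpNorm_weakGrad_sq`). The extension by zero is a limit
of smooth functions on the whole domain, so it lies in `H¹` without losing or gaining energy.

Convergence is then quantitative and needs no compactness in `H¹`: `exists_h1Norm_zeroExtend_sub_le`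
bounds the distance to the constant by the square root of the energy. The Poincaré inequality on the
unperforated domain provides a constant `c` near the function. The trace inequality carries this
closeness to the boundary, where the normalization forces `|c|` to be close to `P(Ω₀)^{-1/2}`, and
positivity decides the sign. Both inequalities are used on the whole domain, so that their constants
do not depend on `r`; the trace constant of the perforated domain does, but it multiplies only an
approximation error that can be made as small as desired.

`poincareOn_self` and `traceOn_frontier` are proved for `C¹` functions: Poincaré by chaining
overlapping pieces, each a ball or a boundary patch that slides into a ball; the trace bound by
integrating along vertical segments below Lipschitz graphs. -/

namespace SteklovDirichlet

/-! ### Poincaré inequality on a ball, by translations. -/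

section Poincare

variable {E : Type*} [NormedAddCommGroup E] [NormedSpace ℝ E]

lemma sq_lintegral_le {α : Type*} [MeasurableSpace α] (μ : Measure α) {f : α → ℝ≥0∞}
    (hf : AEMeasurable f μ) : (∫⁻ x, f x ∂μ) ^ 2 ≤ μ univ * ∫⁻ x, f x ^ 2 ∂μ := by
  have h := ENNReal.lintegral_mul_le_Lp_mul_Lq μ Real.HolderConjugate.two_two
    hf (aemeasurable_const (b := (1 : ℝ≥0∞)))
  simp only [Pi.mul_apply, mul_one, ENNReal.one_rpow, lintegral_const, one_mul] at h
  calc (∫⁻ x, f x ∂μ) ^ 2 ≤ _ := pow_le_pow_left' h 2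
    _ = μ univ * ∫⁻ x, f x ^ 2 ∂μ := by
        rw [mul_pow, ← ENNReal.rpow_natCast, ← ENNReal.rpow_natCast, ← ENNReal.rpow_mul,
          ← ENNReal.rpow_mul]
        simp [mul_comm]

lemma enorm_add_sq_le (a b : ℝ) : ‖a + b‖ₑ ^ 2 ≤ 2 * (‖a‖ₑ ^ 2 + ‖b‖ₑ ^ 2) := by
  have h : ‖a + b‖₊ ^ 2 ≤ 2 * (‖a‖₊ ^ 2 + ‖b‖₊ ^ 2) := by
    rw [← NNReal.coe_le_coe]
    push_cast
    simp only [Real.norm_eq_abs, sq_abs]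
    nlinarith [sq_nonneg (a - b)]
  simp only [enorm_eq_nnnorm]
  exact_mod_cast h

/-- The increment of a `C¹` function is controlled by its derivative along the segment. -/
lemma enorm_sub_sq_le_lintegral {φ : E → ℝ} (hφ : ContDiff ℝ 1 φ) (x v : E) :
    ‖φ (x + v) - φ x‖ₑ ^ 2 ≤
      ‖v‖ₑ ^ 2 * ∫⁻ s in Ioc (0 : ℝ) 1, ‖fderiv ℝ φ (x + s • v)‖ₑ ^ 2 := by
  have hc : Continuous fun s : ℝ => fderiv ℝ φ (x + s • v) :=
    (hφ.continuous_fderiv (by norm_num)).comp (by fun_prop)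
  have hd (s : ℝ) : HasDerivAt (fun s : ℝ => φ (x + s • v)) (fderiv ℝ φ (x + s • v) v) s := by
    have h1 : HasDerivAt (fun s : ℝ => x + s • v) v s := by
      simpa using ((hasDerivAt_id s).smul_const v).const_add x
    exact ((hφ.differentiable (by norm_num)) _).hasFDerivAt.comp_hasDerivAt s h1
  have hftc := intervalIntegral.integral_eq_sub_of_hasDerivAt (a := 0) (b := 1)
    (fun s _ => hd s) ((hc.clm_apply continuous_const).intervalIntegrable _ _)
  simp only [one_smul, zero_smul, add_zero] at hftc
  rw [← hftc, intervalIntegral.integral_of_le zero_le_one]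
  have hm : AEMeasurable (fun s : ℝ => ‖fderiv ℝ φ (x + s • v)‖ₑ)
      (volume.restrict (Ioc (0 : ℝ) 1)) := hc.enorm.measurable.aemeasurable
  have h1 : ‖∫ s in Ioc (0 : ℝ) 1, fderiv ℝ φ (x + s • v) v‖ₑ ≤
      ‖v‖ₑ * ∫⁻ s in Ioc (0 : ℝ) 1, ‖fderiv ℝ φ (x + s • v)‖ₑ := by
    refine (enorm_integral_le_lintegral_enorm _).trans ?_
    rw [← lintegral_const_mul'' _ hm]
    refine lintegral_mono fun s => ?_
    rw [mul_comm]
    exact ContinuousLinearMap.le_opENorm _ _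
  refine (pow_le_pow_left' h1 2).trans ?_
  rw [mul_pow]
  gcongr
  simpa using sq_lintegral_le _ hm

variable [FiniteDimensional ℝ E] [MeasurableSpace E] [BorelSpace E]
  (μ : Measure E) [μ.IsAddHaarMeasure]

/-- The `L²` norm of a difference under translation is controlled by the derivative. -/
lemma lintegral_translate_sub_sq_le {φ : E → ℝ} (hφ : ContDiff ℝ 1 φ) (v : E) {A U : Set E}
    (hA : MeasurableSet A) (hU : MeasurableSet U)
    (hAU : ∀ x ∈ A, ∀ s ∈ Ioc (0 : ℝ) 1, x + s • v ∈ U) :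
    ∫⁻ x in A, ‖φ (x + v) - φ x‖ₑ ^ 2 ∂μ ≤ ‖v‖ₑ ^ 2 * ∫⁻ x in U, ‖fderiv ℝ φ x‖ₑ ^ 2 ∂μ := by
  have hD : Continuous (fderiv ℝ φ) := hφ.continuous_fderiv (by norm_num)
  have hj : Continuous fun p : E × ℝ => ‖fderiv ℝ φ (p.1 + p.2 • v)‖ₑ ^ 2 := by
    have : Continuous fun p : E × ℝ => fderiv ℝ φ (p.1 + p.2 • v) := hD.comp (by fun_prop)
    exact (ENNReal.continuous_pow 2).comp this.enorm
  calc ∫⁻ x in A, ‖φ (x + v) - φ x‖ₑ ^ 2 ∂μ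
      ≤ ∫⁻ x in A, ‖v‖ₑ ^ 2 *
          ∫⁻ s in Ioc (0 : ℝ) 1, ‖fderiv ℝ φ (x + s • v)‖ₑ ^ 2 ∂volume ∂μ :=
        lintegral_mono fun x => enorm_sub_sq_le_lintegral hφ x v
    _ = ‖v‖ₑ ^ 2 * ∫⁻ s in Ioc (0 : ℝ) 1, ∫⁻ x in A, ‖fderiv ℝ φ (x + s • v)‖ₑ ^ 2 ∂μ := by
        rw [lintegral_const_mul' _ _ (by simp), lintegral_lintegral_swap]
        exact hj.measurable.aemeasurable
    _ ≤ ‖v‖ₑ ^ 2 * ∫⁻ s in Ioc (0 : ℝ) 1, ∫⁻ x in U, ‖fderiv ℝ φ x‖ₑ ^ 2 ∂μ := by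
        gcongr ‖v‖ₑ ^ 2 * ?_
        refine setLIntegral_mono' measurableSet_Ioc fun s hs => ?_
        rw [← lintegral_indicator hA, ← lintegral_indicator hU,
          ← lintegral_add_right_eq_self (U.indicator _) (s • v)]
        refine lintegral_mono fun x => ?_
        by_cases hx : x ∈ A
        · simp [hx, hAU x hx s hs]
        · simp [hx]
    _ = ‖v‖ₑ ^ 2 * ∫⁻ x in U, ‖fderiv ℝ φ x‖ₑ ^ 2 ∂μ := by simp

/-- Poincaré inequality on a ball. -/
lemma poincare_ball (a : E) {R : ℝ} (hR : 0 < R) :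
    ∃ C : ℝ≥0∞, C ≠ ⊤ ∧ ∀ φ : E → ℝ, ContDiff ℝ 1 φ → ∃ c : ℝ,
      ∫⁻ x in Metric.ball a R, ‖φ x - c‖ₑ ^ 2 ∂μ ≤
        C * ∫⁻ x in Metric.ball a R, ‖fderiv ℝ φ x‖ₑ ^ 2 ∂μ := by
  set B := Metric.ball a R with hB
  have hBm : MeasurableSet B := Metric.isOpen_ball.measurableSet
  have hB0 : μ B ≠ 0 := (Metric.measure_ball_pos μ a hR).ne'
  have hBt : μ B ≠ ⊤ := measure_ball_lt_top.ne
  set V := Metric.ball (0 : E) (2 * R)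
  have hVt : μ V ≠ ⊤ := measure_ball_lt_top.ne
  refine ⟨ENNReal.ofReal (2 * R) ^ 2 * μ V / μ B, ?_, fun φ hφ => ?_⟩
  · exact ENNReal.div_ne_top (ENNReal.mul_ne_top (ENNReal.pow_ne_top ENNReal.ofReal_ne_top) hVt) hB0
  set I := ∫⁻ x in B, ‖fderiv ℝ φ x‖ₑ ^ 2 ∂μ
  have hcont : Continuous φ := hφ.continuous
  have hj : Measurable fun p : E × E => ‖φ p.2 - φ p.1‖ₑ ^ 2 := by
    have : Continuous fun p : E × E => φ p.2 - φ p.1 := by fun_prop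
    exact ((ENNReal.continuous_pow 2).comp this.enorm).measurable
  -- Integrate over all pairs and substitute `x = v + y`. Only shifts with `‖v‖ < 2R` join two
  -- points of the ball, and by convexity the segment between them stays inside, so each shift costs
  -- at most `(2R)²` times the energy.
  have key : ∫⁻ y in B, ∫⁻ x in B, ‖φ x - φ y‖ₑ ^ 2 ∂μ ∂μ ≤
      ENNReal.ofReal (2 * R) ^ 2 * μ V * I := by
    calc ∫⁻ y in B, ∫⁻ x in B, ‖φ x - φ y‖ₑ ^ 2 ∂μ ∂μ
        = ∫⁻ y in B, ∫⁻ v, (B.indicator fun x => ‖φ x - φ y‖ₑ ^ 2) (v + y) ∂μ ∂μ := by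
          refine lintegral_congr fun y => ?_
          rw [← lintegral_indicator hBm, lintegral_add_right_eq_self]
      _ = ∫⁻ v, ∫⁻ y in B, (B.indicator fun x => ‖φ x - φ y‖ₑ ^ 2) (v + y) ∂μ ∂μ := by
          rw [lintegral_lintegral_swap]
          refine Measurable.aemeasurable ?_
          have : (Function.uncurry fun y v : E =>
              (B.indicator fun x => ‖φ x - φ y‖ₑ ^ 2) (v + y)) =
              {p : E × E | p.2 + p.1 ∈ B}.indicator
                (fun p : E × E => ‖φ (p.2 + p.1) - φ p.1‖ₑ ^ 2) := by
            ext p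
            simp [Function.uncurry, indicator]
          rw [this]
          refine Measurable.indicator ?_ (hBm.preimage (by fun_prop))
          exact hj.comp (g := fun p : E × E => ‖φ p.2 - φ p.1‖ₑ ^ 2)
            (f := fun p : E × E => (p.1, p.2 + p.1)) (by fun_prop)
      _ ≤ ∫⁻ v, V.indicator (fun _ => ENNReal.ofReal (2 * R) ^ 2 * I) v ∂μ := by
          refine lintegral_mono fun v => ?_
          by_cases hv : v ∈ V
          · rw [indicator_of_mem hv]
            have hv' : ‖v‖ₑ ≤ ENNReal.ofReal (2 * R) := by
              rw [← ofReal_norm]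
              exact ENNReal.ofReal_le_ofReal (mem_ball_zero_iff.1 hv).le
            calc ∫⁻ y in B, (B.indicator fun x => ‖φ x - φ y‖ₑ ^ 2) (v + y) ∂μ
                = ∫⁻ y in B ∩ {y | y + v ∈ B}, ‖φ (y + v) - φ y‖ₑ ^ 2 ∂μ := by
                  have hS : MeasurableSet {y | y + v ∈ B} := hBm.preimage (by fun_prop)
                  rw [← lintegral_indicator hBm, ← lintegral_indicator (hBm.inter hS)]
                  refine lintegral_congr fun y => ?_
                  by_cases h1 : y ∈ B <;> by_cases h2 : y + v ∈ B <;>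
                    simp [h1, h2, add_comm v y]
              _ ≤ ‖v‖ₑ ^ 2 * I := by
                  refine lintegral_translate_sub_sq_le μ hφ v
                    (hBm.inter (hBm.preimage (by fun_prop))) hBm ?_
                  rintro x ⟨hx, hxv⟩ s hs
                  exact (convex_ball a R).add_smul_mem hx hxv ⟨hs.1.le, hs.2⟩
              _ ≤ _ := by gcongr
          · rw [indicator_of_notMem hv]
            refine le_of_eq ?_
            rw [setLIntegral_eq_zero hBm]
            intro y hy
            refine indicator_of_notMem (fun h => hv ?_) _
            rw [hB, Metric.mem_ball, dist_eq_norm] at hy h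
            rw [mem_ball_zero_iff]
            calc ‖v‖ = ‖(v + y - a) - (y - a)‖ := by congr 1; abel
              _ ≤ ‖v + y - a‖ + ‖y - a‖ := norm_sub_le _ _
              _ < 2 * R := by linarith
      _ = _ := by
          rw [lintegral_indicator Metric.isOpen_ball.measurableSet]
          simp only [lintegral_const, Measure.restrict_apply MeasurableSet.univ, univ_inter]
          ring
  -- The constant need not be the mean of `φ`: the value at a point where the inner integral is at
  -- most its average over the ball will do.
  obtain ⟨y, -, hy⟩ := exists_le_setLAverage hB0 hBt
    (f := fun y => ∫⁻ x in B, ‖φ x - φ y‖ₑ ^ 2 ∂μ)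
    (hj.lintegral_prod_right' (ν := μ.restrict B)).aemeasurable
  refine ⟨φ y, hy.trans ?_⟩
  rw [setLAverage_eq, ENNReal.div_eq_inv_mul, ENNReal.div_eq_inv_mul, mul_assoc]
  gcongr

end Poincare

/-! ### Poincaré inequality on a connected Lipschitz domain. -/

section PoincareDomain

variable {n : ℕ}

lemma norm_sub_inner_smul_le {E : Type*} [NormedAddCommGroup E] [InnerProductSpace ℝ E] {e : E}
    (he : ‖e‖ = 1) (x : E) : ‖x - inner ℝ x e • e‖ ≤ ‖x‖ := by
  refine le_of_sq_le_sq ?_ (norm_nonneg _)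
  rw [norm_sub_sq_real, inner_smul_right, norm_smul, he]
  simp only [Real.norm_eq_abs, mul_one, sq_abs]
  nlinarith [sq_nonneg (inner ℝ x e)]

lemma lipschitz_horizontal_le {E : Type*} [NormedAddCommGroup E] [InnerProductSpace ℝ E] {e : E}
    (he : ‖e‖ = 1) {K : ℝ≥0} {g : E → ℝ} (hg : LipschitzWith K g) (x y : E) :
    |g (x - inner ℝ x e • e) - g (y - inner ℝ y e • e)| ≤ K * ‖x - y‖ := by
  rw [← Real.dist_eq]
  refine (hg.dist_le_mul _ _).trans ?_
  gcongr
  rw [dist_eq_norm]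
  refine le_trans (le_of_eq ?_) (norm_sub_inner_smul_le he (x - y))
  rw [inner_sub_left, sub_smul]
  congr 1
  abel

lemma inner_sub_smul_self {E : Type*} [NormedAddCommGroup E] [InnerProductSpace ℝ E] {e : E}
    (he : ‖e‖ = 1) (x : E) (s : ℝ) : inner ℝ (x - s • e) e = inner ℝ x e - s := by
  rw [inner_sub_left, inner_smul_left, real_inner_self_eq_norm_sq, he]
  simp

lemma horizontal_sub_smul_self {E : Type*} [NormedAddCommGroup E] [InnerProductSpace ℝ E] {e : E}
    (he : ‖e‖ = 1) (x : E) (s : ℝ) :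
    (x - s • e) - inner ℝ (x - s • e) e • e = x - inner ℝ x e • e := by
  rw [inner_sub_smul_self he, sub_smul]
  abel

/-- A boundary point in a Lipschitz chart lies on the graph. -/
lemma inner_eq_of_mem_frontier {Ω : Set (EuclideanSpace ℝ (Fin n))} (hΩ : IsOpen Ω)
    {e : EuclideanSpace ℝ (Fin n)} {g : EuclideanSpace ℝ (Fin n) → ℝ} (hg : Continuous g)
    {p : EuclideanSpace ℝ (Fin n)} {δ : ℝ}
    (h : ∀ x ∈ Metric.ball p δ, (x ∈ Ω ↔ inner ℝ x e < g (x - inner ℝ x e • e)))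
    {q : EuclideanSpace ℝ (Fin n)} (hq : q ∈ Metric.ball p δ) (hqf : q ∈ frontier Ω) :
    inner ℝ q e = g (q - inner ℝ q e • e) := by
  rw [hΩ.frontier_eq] at hqf
  refine le_antisymm ?_ (not_lt.1 fun hlt => hqf.2 ((h q hq).2 hlt))
  have hcl : IsClosed {x : EuclideanSpace ℝ (Fin n) | inner ℝ x e ≤ g (x - inner ℝ x e • e)} :=
    isClosed_le (by fun_prop) (by fun_prop)
  have hq' : q ∈ closure (Metric.ball p δ ∩ Ω) :=
    Metric.isOpen_ball.inter_closure ⟨hq, hqf.1⟩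
  exact closure_minimal (fun x hx => ((h x hx.1).1 hx.2).le) hcl hq'

/-- A Poincaré inequality on `U`, with the full gradient energy of `Ω` on the right. -/
def PoincareOn (Ω U : Set (EuclideanSpace ℝ (Fin n))) : Prop :=
  ∃ C : ℝ≥0∞, C ≠ ⊤ ∧ ∀ φ : EuclideanSpace ℝ (Fin n) → ℝ, ContDiff ℝ 1 φ → ∃ c : ℝ,
    ∫⁻ x in U, ‖φ x - c‖ₑ ^ 2 ≤ C * ∫⁻ x in Ω, ‖fderiv ℝ φ x‖ₑ ^ 2

variable {Ω U V : Set (EuclideanSpace ℝ (Fin n))}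

lemma PoincareOn.mono (h : PoincareOn Ω V) (hUV : U ⊆ V) : PoincareOn Ω U := by
  obtain ⟨C, hC, h⟩ := h
  refine ⟨C, hC, fun φ hφ => ?_⟩
  obtain ⟨c, hc⟩ := h φ hφ
  exact ⟨c, (lintegral_mono_set hUV).trans hc⟩

lemma lintegral_enorm_sub_sq_le {α : Type*} [MeasurableSpace α] {μ : Measure α} {f g h : α → ℝ}
    (hf : Measurable f) (hg : Measurable g) :
    ∫⁻ x, ‖f x - h x‖ₑ ^ 2 ∂μ ≤
      2 * (∫⁻ x, ‖f x - g x‖ₑ ^ 2 ∂μ + ∫⁻ x, ‖g x - h x‖ₑ ^ 2 ∂μ) := by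
  have hm : Measurable fun x => ‖f x - g x‖ₑ ^ 2 := (hf.sub hg).enorm.pow_const 2
  rw [← lintegral_add_left hm, ← lintegral_const_mul' _ _ (by simp)]
  refine lintegral_mono fun x => ?_
  simpa using enorm_add_sq_le (f x - g x) (g x - h x)

/-- On the overlap `φ` is close to both constants, so these are close to each other, by an amount
divided by the measure of the overlap. The constant of `U` can therefore replace that of `V`. -/
lemma PoincareOn.union (hU : PoincareOn Ω U) (hV : PoincareOn Ω V)
    (hUV : volume (U ∩ V) ≠ 0) (hVt : volume V ≠ ⊤) : PoincareOn Ω (U ∪ V) := by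
  obtain ⟨C, hC, hU⟩ := hU
  obtain ⟨D, hD, hV⟩ := hV
  have hUVt : volume (U ∩ V) ≠ ⊤ := measure_ne_top_of_subset inter_subset_right hVt
  refine ⟨C + 2 * (D + 2 * (C + D) / volume (U ∩ V) * volume V), ?_, fun φ hφ => ?_⟩
  · have : 2 * (C + D) / volume (U ∩ V) ≠ ⊤ :=
      ENNReal.div_ne_top (ENNReal.mul_ne_top (by simp) (by simp [hC, hD])) hUV
    exact ENNReal.add_ne_top.2 ⟨hC, ENNReal.mul_ne_top (by simp)
      (ENNReal.add_ne_top.2 ⟨hD, ENNReal.mul_ne_top this hVt⟩)⟩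
  obtain ⟨c, hc⟩ := hU φ hφ
  obtain ⟨d, hd⟩ := hV φ hφ
  set I := ∫⁻ x in Ω, ‖fderiv ℝ φ x‖ₑ ^ 2
  have hm : Measurable φ := hφ.continuous.measurable
  have hcd : ‖d - c‖ₑ ^ 2 ≤ 2 * (C + D) * I / volume (U ∩ V) := by
    rw [ENNReal.le_div_iff_mul_le (Or.inl hUV) (Or.inl hUVt), ← setLIntegral_const]
    refine (lintegral_enorm_sub_sq_le (f := fun _ => d) (g := φ) (h := fun _ => c)
      measurable_const hm).trans ?_
    rw [mul_assoc, add_mul, add_comm (C * I)]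
    gcongr
    · simp_rw [enorm_sub_rev d]
      exact (lintegral_mono_set inter_subset_right).trans hd
    · exact (lintegral_mono_set inter_subset_left).trans hc
  refine ⟨c, (lintegral_union_le _ _ _).trans ?_⟩
  rw [add_mul]
  gcongr
  refine (lintegral_enorm_sub_sq_le (f := φ) (g := fun _ => d) (h := fun _ => c)
    hm measurable_const).trans ?_
  rw [mul_assoc, add_mul, setLIntegral_const]
  refine mul_le_mul_right (add_le_add hd ?_) _
  calc ‖d - c‖ₑ ^ 2 * volume V ≤ 2 * (C + D) * I / volume (U ∩ V) * volume V := by gcongr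
    _ = 2 * (C + D) / volume (U ∩ V) * volume V * I := by simp only [div_eq_mul_inv]; ring

lemma poincareOn_ball {a : EuclideanSpace ℝ (Fin n)} {R : ℝ} (hR : 0 < R)
    (h : Metric.ball a R ⊆ Ω) : PoincareOn Ω (Metric.ball a R) := by
  obtain ⟨C, hC, H⟩ := poincare_ball (volume : Measure (EuclideanSpace ℝ (Fin n))) a hR
  refine ⟨C, hC, fun φ hφ => ?_⟩
  obtain ⟨c, hc⟩ := H φ hφ
  exact ⟨c, hc.trans (by gcongr)⟩

/-- If a set can be translated along segments in `Ω` into a ball in `Ω`, then it satisfies a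
Poincaré inequality. -/
lemma poincareOn_of_translate (hΩ : IsOpen Ω) {A : Set (EuclideanSpace ℝ (Fin n))}
    (hA : MeasurableSet A) {v a : EuclideanSpace ℝ (Fin n)} {R : ℝ} (hR : 0 < R)
    (hB : Metric.ball a R ⊆ Ω) (hAΩ : ∀ x ∈ A, ∀ s ∈ Ioc (0 : ℝ) 1, x + s • v ∈ Ω)
    (hAB : ∀ x ∈ A, x + v ∈ Metric.ball a R) : PoincareOn Ω A := by
  obtain ⟨C, hC, H⟩ := poincareOn_ball hR hB
  refine ⟨2 * (‖v‖ₑ ^ 2 + C), ENNReal.mul_ne_top (by simp) (by simp [hC]), fun φ hφ => ?_⟩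
  obtain ⟨c, hc⟩ := H φ hφ
  have hm : Measurable φ := hφ.continuous.measurable
  refine ⟨c, (lintegral_enorm_sub_sq_le (f := φ) (g := fun x => φ (x + v)) (h := fun _ => c)
    hm (hm.comp (measurable_id.add_const v))).trans ?_⟩
  rw [mul_assoc, add_mul]
  gcongr
  · simp_rw [enorm_sub_rev (φ _) (φ (_ + v))]
    exact lintegral_translate_sub_sq_le volume hφ v hA hΩ.measurableSet hAΩ
  · refine le_trans ?_ hc
    rw [← lintegral_indicator hA, ← lintegral_indicator Metric.isOpen_ball.measurableSet,
      ← lintegral_add_right_eq_self (Set.indicator (Metric.ball a R) _) v]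
    refine lintegral_mono fun x => ?_
    by_cases hx : x ∈ A
    · rw [indicator_of_mem hx, indicator_of_mem (hAB x hx)]
    · simp [hx]

/-- Every point of the closure of a Lipschitz domain has a neighbourhood in which a Poincaré
inequality holds. -/
lemma exists_poincareOn_nhds (hΩ : IsOpen Ω) (hlip : HasLipschitzBoundary Ω)
    {p : EuclideanSpace ℝ (Fin n)} (hp : p ∈ closure Ω) :
    ∃ η > 0, PoincareOn Ω (Metric.ball p η ∩ Ω) := by
  by_cases hpΩ : p ∈ Ω
  · obtain ⟨η, hη, h⟩ := Metric.isOpen_iff.1 hΩ p hpΩ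
    exact ⟨η, hη, (poincareOn_ball hη h).mono inter_subset_left⟩
  have hpf : p ∈ frontier Ω := by rw [hΩ.frontier_eq]; exact ⟨hp, hpΩ⟩
  obtain ⟨e, he, K, g, hg, δ, hδ, h⟩ := hlip p hpf
  have hpe := inner_eq_of_mem_frontier hΩ hg.continuous h (Metric.mem_ball_self hδ) hpf
  have hK : (0 : ℝ) ≤ K := K.2
  -- In the ball of radius `η` a point rises above the graph by at most `(1 + K)η`. Descending by
  -- `(2 + K)η` thus brings the entire ball into `Ω`, and the condition on `η` keeps the motion
  -- inside the chart.
  obtain ⟨η, hη, hηδ⟩ : ∃ η : ℝ, 0 < η ∧ η + (2 + K) * η < δ := by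
    refine ⟨δ / (4 + K), by positivity, ?_⟩
    rw [← one_add_mul, ← mul_div_assoc, div_lt_iff₀ (by positivity)]
    nlinarith
  set s₀ : ℝ := (2 + K) * η with hs₀
  have hs₀pos : 0 < s₀ := by positivity
  have hmem (x : EuclideanSpace ℝ (Fin n)) (hx : x ∈ Metric.ball p η) (s : ℝ) (hs : 0 ≤ s)
      (hs' : s ≤ s₀) : x - s • e ∈ Metric.ball p δ := by
    rw [Metric.mem_ball, dist_eq_norm] at hx ⊢
    calc ‖x - s • e - p‖ = ‖(x - p) - s • e‖ := by congr 1; abel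
      _ ≤ ‖x - p‖ + ‖s • e‖ := norm_sub_le _ _
      _ < δ := by
        rw [norm_smul, he, Real.norm_of_nonneg hs]
        linarith
  refine ⟨η, hη, poincareOn_of_translate hΩ (Metric.isOpen_ball.inter hΩ).measurableSet
    (v := -(s₀ • e)) (a := p - s₀ • e) hη ?_ ?_ ?_⟩
  · intro z hz
    obtain ⟨x, rfl⟩ : ∃ x, z = x - s₀ • e := ⟨z + s₀ • e, by abel⟩
    have hx : x ∈ Metric.ball p η := by
      rw [Metric.mem_ball, dist_eq_norm] at hz ⊢
      simpa using hz
    rw [h _ (hmem x hx s₀ hs₀pos.le le_rfl), horizontal_sub_smul_self he, inner_sub_smul_self he]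
    rw [Metric.mem_ball, dist_eq_norm] at hx
    have h1 := (abs_le.1 (lipschitz_horizontal_le he hg x p)).1
    have h2 : inner ℝ x e - inner ℝ p e ≤ ‖x - p‖ := by
      rw [← inner_sub_left]
      simpa [he] using real_inner_le_norm (x - p) e
    have h3 : K * ‖x - p‖ ≤ K * η := by gcongr
    nlinarith
  -- Descending changes the height but not the horizontal part, so a point below the graph stays
  -- below it.
  · rintro x ⟨hx, hxΩ⟩ s ⟨hs, hs1⟩
    have hss : x + s • -(s₀ • e) = x - (s * s₀) • e := by
      rw [smul_neg, smul_smul, sub_eq_add_neg]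
    have hs0 : 0 ≤ s * s₀ := by positivity
    have hs1' : s * s₀ ≤ s₀ := mul_le_of_le_one_left hs₀pos.le hs1
    rw [hss, h _ (hmem x hx _ hs0 hs1'), horizontal_sub_smul_self he, inner_sub_smul_self he]
    have hxδ : x ∈ Metric.ball p δ := by simpa using hmem x hx 0 le_rfl hs₀pos.le
    linarith [(h x hxδ).1 hxΩ]
  · rintro x ⟨hx, -⟩
    rw [Metric.mem_ball, dist_eq_norm] at hx ⊢
    simpa [sub_eq_add_neg] using hx

/-- Poincaré inequality on a bounded connected Lipschitz domain. -/
theorem poincareOn_self (hΩ : IsOpen Ω) (hb : Bornology.IsBounded Ω) (hc : IsConnected Ω)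
    (hlip : HasLipschitzBoundary Ω) : PoincareOn Ω Ω := by
  obtain ⟨x₀, hx₀⟩ := hc.nonempty
  have hfin (W : Set (EuclideanSpace ℝ (Fin n))) (hW : W ⊆ Ω) : volume W ≠ ⊤ :=
    (hb.subset hW).measure_lt_top.ne
  -- Every admissible `U` is also a neighbourhood of `x₀`. Two such sets therefore overlap in
  -- positive measure and can be merged. Connectedness gives `Ω ⊆ S` once `S` is shown open and
  -- relatively closed in `Ω`.
  set S : Set (EuclideanSpace ℝ (Fin n)) :=
    {x | ∃ U ⊆ Ω, U ∈ 𝓝 x ∧ U ∈ 𝓝 x₀ ∧ PoincareOn Ω U} with hS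
  have hSopen : IsOpen S := by
    rw [isOpen_iff_mem_nhds]
    rintro x ⟨U, hU, hUx, hU0, hP⟩
    filter_upwards [eventually_mem_nhds_iff.2 hUx] with y hy
    exact ⟨U, hU, hy, hU0, hP⟩
  have key {x : EuclideanSpace ℝ (Fin n)} {η : ℝ} (hη : PoincareOn Ω (Metric.ball x η ∩ Ω))
      {y : EuclideanSpace ℝ (Fin n)} (hy : y ∈ Metric.ball x η ∩ Ω) (hyS : y ∈ S) :
      ∃ U ⊆ Ω, Metric.ball x η ∩ Ω ⊆ U ∧ U ∈ 𝓝 x₀ ∧ PoincareOn Ω U := by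
    obtain ⟨U, hU, hUy, hU0, hP⟩ := hyS
    refine ⟨(Metric.ball x η ∩ Ω) ∪ U, union_subset inter_subset_right hU, subset_union_left,
      mem_of_superset hU0 subset_union_right, hη.union hP ?_ (hfin U hU)⟩
    exact (Measure.measure_pos_of_mem_nhds volume
      (inter_mem ((Metric.isOpen_ball.inter hΩ).mem_nhds hy) hUy)).ne'
  have hx₀S : x₀ ∈ S := by
    obtain ⟨η, hη, h⟩ := exists_poincareOn_nhds hΩ hlip (subset_closure hx₀)
    have := (Metric.isOpen_ball.inter hΩ).mem_nhds ⟨Metric.mem_ball_self hη, hx₀⟩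
    exact ⟨_, inter_subset_right, this, this, h⟩
  have hΩS : Ω ⊆ S := by
    refine hc.isPreconnected.subset_of_closure_inter_subset hSopen ⟨x₀, hx₀, hx₀S⟩ ?_
    rintro x ⟨hxS, hxΩ⟩
    obtain ⟨η, hη, h⟩ := exists_poincareOn_nhds hΩ hlip (subset_closure hxΩ)
    have hN := (Metric.isOpen_ball.inter hΩ).mem_nhds ⟨Metric.mem_ball_self hη, hxΩ⟩
    obtain ⟨y, hy, hyS⟩ := mem_closure_iff_nhds.1 hxS _ hN
    obtain ⟨U, hU, hsub, hU0, hP⟩ := key h hy hyS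
    exact ⟨U, hU, mem_of_superset hN hsub, hU0, hP⟩
  -- Compactness of the closure, boundary patches included, reduces the covering to finitely many
  -- pieces. Each piece is first linked to `x₀`, so that the merging above applies.
  have hcov : ∃ U ⊆ Ω, closure Ω ∩ Ω ⊆ U ∧ U ∈ 𝓝 x₀ ∧ PoincareOn Ω U := by
    refine hb.isCompact_closure.induction_on
      (p := fun s => ∃ U ⊆ Ω, s ∩ Ω ⊆ U ∧ U ∈ 𝓝 x₀ ∧ PoincareOn Ω U) ?_ ?_ ?_ ?_
    · obtain ⟨U, hU, -, hU0, hP⟩ := hx₀S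
      exact ⟨U, hU, by simp, hU0, hP⟩
    · rintro s t hst ⟨U, hU, htU, h⟩
      exact ⟨U, hU, (inter_subset_inter_left _ hst).trans htU, h⟩
    · rintro s t ⟨U, hU, hsU, hU0, hPU⟩ ⟨V, hV, htV, hV0, hPV⟩
      refine ⟨U ∪ V, union_subset hU hV, ?_, mem_of_superset hU0 subset_union_left,
        hPU.union hPV (Measure.measure_pos_of_mem_nhds volume (inter_mem hU0 hV0)).ne' (hfin V hV)⟩
      rw [union_inter_distrib_right]
      exact union_subset_union hsU htV
    · intro x hx
      obtain ⟨η, hη, h⟩ := exists_poincareOn_nhds hΩ hlip hx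
      obtain ⟨y, hy⟩ := mem_closure_iff_nhds.1 hx _ (Metric.ball_mem_nhds x hη)
      exact ⟨Metric.ball x η, mem_nhdsWithin_of_mem_nhds (Metric.ball_mem_nhds x hη),
        key h hy (hΩS hy.2)⟩
  obtain ⟨U, -, hsub, -, hP⟩ := hcov
  exact hP.mono fun x hx => hsub ⟨subset_closure hx, hx⟩

end PoincareDomain

/-! ### Trace inequality on the boundary of a Lipschitz domain. -/

section TraceInequality

/-- One-dimensional trace inequality. -/
lemma enorm_sq_le_lintegral_Ioc {a a' : ℝ → ℝ} (ha : ∀ t, HasDerivAt a (a' t) t)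
    (ha' : Continuous a') {h : ℝ} (hh : 0 < h) :
    ‖a 0‖ₑ ^ 2 ≤ ENNReal.ofReal (1 / h + 1) *
      ∫⁻ t in Ioc (0 : ℝ) h, (‖a t‖ₑ ^ 2 + ‖a' t‖ₑ ^ 2) := by
  have hac : Continuous a := continuous_iff_continuousAt.2 fun t => (ha t).continuousAt
  -- The weight is `-1` at `0` and vanishes at `h`, so the integral of this derivative is exactly `a
  -- 0 ^ 2`. The cross term is absorbed by `2|a a'| ≤ a² + a'²`.
  have hd (t : ℝ) : HasDerivAt (fun t => (t / h - 1) * a t ^ 2)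
      (1 / h * a t ^ 2 + (t / h - 1) * (2 * a t * a' t)) t := by
    refine ((((hasDerivAt_id t).div_const h).sub_const 1).mul ((ha t).pow 2)).congr_deriv ?_
    simp
  have hftc := intervalIntegral.integral_eq_sub_of_hasDerivAt (a := 0) (b := h)
    (fun t _ => hd t) (by
      apply Continuous.intervalIntegrable
      fun_prop)
  rw [div_self hh.ne'] at hftc
  simp only [sub_self, zero_mul, zero_div, zero_sub, neg_mul, one_mul, neg_neg] at hftc
  rw [intervalIntegral.integral_of_le hh.le] at hftc
  have hle : a 0 ^ 2 ≤ ∫ t in Ioc 0 h, (1 / h + 1) * (a t ^ 2 + a' t ^ 2) := by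
    rw [← hftc]
    refine setIntegral_mono_on ?_ ?_ measurableSet_Ioc fun t ht => ?_
    · exact (Continuous.integrableOn_Icc (by fun_prop)).mono_set Ioc_subset_Icc_self
    · exact (Continuous.integrableOn_Icc (by fun_prop)).mono_set Ioc_subset_Icc_self
    · have h0 : 0 ≤ 1 - t / h := by
        rw [sub_nonneg, div_le_one hh]
        exact ht.2
      have h1 : 0 ≤ t / h := by
        have := ht.1
        positivity
      have h2 : 0 ≤ 1 / h := by positivity
      nlinarith [mul_nonneg h0 (sq_nonneg (a t + a' t)), mul_nonneg h1 (sq_nonneg (a t)),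
        mul_nonneg h1 (sq_nonneg (a' t)), mul_nonneg h2 (sq_nonneg (a' t))]
  have hnn : 0 ≤ 1 / h + 1 := by positivity
  have hsq (x : ℝ) : ‖x‖ₑ ^ 2 = ENNReal.ofReal (x ^ 2) := by
    rw [← Real.enorm_of_nonneg (sq_nonneg x), enorm_pow]
  rw [hsq, ← lintegral_const_mul' _ _ ENNReal.ofReal_ne_top]
  refine (ENNReal.ofReal_le_ofReal hle).trans (le_of_eq ?_)
  rw [ofReal_integral_eq_lintegral_ofReal]
  · refine lintegral_congr fun t => ?_
    rw [hsq, hsq, ENNReal.ofReal_mul hnn, ENNReal.ofReal_add (sq_nonneg _) (sq_nonneg _)]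
  · exact (Continuous.integrableOn_Icc (by fun_prop)).mono_set Ioc_subset_Icc_self
  · exact Eventually.of_forall fun t => by positivity

lemma euclideanHausdorffMeasure_image_le {X Y : Type*} [EMetricSpace X] [MeasurableSpace X]
    [BorelSpace X] [EMetricSpace Y] [MeasurableSpace Y] [BorelSpace Y] {f : X → Y} {L : ℝ≥0}
    (hf : LipschitzWith L f) (d : ℕ) (s : Set X) :
    μHE[d] (f '' s) ≤ (L : ℝ≥0∞) ^ d * μHE[d] s := by
  simp only [Measure.euclideanHausdorffMeasure_def, Measure.smul_apply, ENNReal.smul_def,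
    smul_eq_mul]
  rw [mul_left_comm]
  gcongr
  simpa using hf.hausdorffMeasure_image_le (d := (d : ℝ)) (by positivity) s

/-- An upper bound suffices, so neither the area formula nor injectivity is needed: since `F`
enlarges Hausdorff measure by at most `L ^ d`, the measure on the image is dominated by that
multiple of a pushforward. -/
lemma lintegral_image_euclideanHausdorffMeasure_le {X Y : Type*} [EMetricSpace X]
    [MeasurableSpace X] [BorelSpace X] [EMetricSpace Y] [MeasurableSpace Y] [BorelSpace Y]
    {F : X → Y} {L : ℝ≥0} (hF : LipschitzWith L F) (d : ℕ) (W : Set X) {f : Y → ℝ≥0∞}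
    (hf : Measurable f) :
    ∫⁻ x in F '' W, f x ∂μHE[d] ≤ (L : ℝ≥0∞) ^ d * ∫⁻ y in W, f (F y) ∂μHE[d] := by
  have hFm : Measurable F := hF.continuous.measurable
  rw [← lintegral_map hf hFm, ← smul_eq_mul, ← lintegral_smul_measure]
  refine lintegral_mono' (Measure.le_iff.2 fun A hA => ?_) le_rfl
  rw [Measure.restrict_apply hA, Measure.smul_apply, Measure.map_apply hFm hA,
    Measure.restrict_apply (hFm hA), smul_eq_mul]
  refine (measure_mono ?_).trans (euclideanHausdorffMeasure_image_le hF d _)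
  rintro _ ⟨hx, y, hy, rfl⟩
  exact ⟨y, ⟨hx, hy⟩, rfl⟩

/-- Fubini in the coordinates given by a unit vector and its orthogonal complement. -/
lemma lintegral_eq_lintegral_orthogonal {E : Type*} [NormedAddCommGroup E]
    [InnerProductSpace ℝ E] [FiniteDimensional ℝ E] [MeasurableSpace E] [BorelSpace E] {e : E}
    (he : ‖e‖ = 1) {f : E → ℝ≥0∞} (hf : Measurable f) :
    ∫⁻ x, f x = ∫⁻ y : (ℝ ∙ e)ᗮ, ∫⁻ t : ℝ, f (y + t • e) := by
  have h1 := ((ℝ ∙ e).measurePreserving_measurableEquivProd (0 : E)).symm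
  rw [InnerProductSpace.euclideanHausdorffMeasure_eq_volume] at h1
  rw [← h1.lintegral_comp_emb (MeasurableEquiv.measurableEmbedding _),
    Measure.volume_eq_prod, lintegral_prod_symm]
  · refine lintegral_congr fun y => ?_
    have h2 := (LinearIsometryEquiv.toSpanUnitSingleton e he).measurePreserving
    rw [← h2.lintegral_comp_emb
      (LinearIsometryEquiv.toSpanUnitSingleton e he).toMeasurableEquiv.measurableEmbedding]
    refine lintegral_congr fun t => ?_
    simp [add_comm]
  · exact (hf.comp (MeasurableEquiv.measurable _)).aemeasurable

variable {n : ℕ}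

/-- A trace inequality on `Γ`, with the `H¹` norm in `U` on the right. -/
def TraceOn (U Γ : Set (EuclideanSpace ℝ (Fin n))) : Prop :=
  ∃ C : ℝ≥0∞, C ≠ ⊤ ∧ ∀ φ : EuclideanSpace ℝ (Fin n) → ℝ, ContDiff ℝ 1 φ →
    ∫⁻ x in Γ, ‖φ x‖ₑ ^ 2 ∂μHE[n - 1] ≤
      C * ∫⁻ x in U, (‖φ x‖ₑ ^ 2 + ‖fderiv ℝ φ x‖ₑ ^ 2)

variable {Ω K : Set (EuclideanSpace ℝ (Fin n))}

/-- Local trace inequality along the graph of a Lipschitz function. -/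
lemma traceOn_graph {U : Set (EuclideanSpace ℝ (Fin n))} (hU : MeasurableSet U)
    {e : EuclideanSpace ℝ (Fin n)} (he : ‖e‖ = 1) {L : ℝ≥0}
    {g : EuclideanSpace ℝ (Fin n) → ℝ} (hg : LipschitzWith L g) {h : ℝ} (hh : 0 < h)
    {W : Set (ℝ ∙ e)ᗮ} (hW : MeasurableSet W)
    (hWU : ∀ y ∈ W, ∀ t ∈ Ioc 0 h, (y : EuclideanSpace ℝ (Fin n)) + (g y - t) • e ∈ U) :
    TraceOn U ((fun y : (ℝ ∙ e)ᗮ => (y : EuclideanSpace ℝ (Fin n)) + g y • e) '' W) := by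
  set F := fun y : (ℝ ∙ e)ᗮ => (y : EuclideanSpace ℝ (Fin n)) + g y • e with hFdef
  have hgV : LipschitzWith L fun y : (ℝ ∙ e)ᗮ => g y := by
    have := hg.comp (LipschitzWith.subtype_val ((ℝ ∙ e)ᗮ : Set (EuclideanSpace ℝ (Fin n))))
    rwa [mul_one] at this
  have hF : LipschitzWith (1 + L) F := by
    refine (LipschitzWith.subtype_val _).add ?_
    refine LipschitzWith.of_dist_le_mul fun x y => ?_
    rw [dist_eq_norm, ← sub_smul, norm_smul, he, mul_one]
    exact hgV.dist_le_mul x y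
  -- A unit vector exists only if `n ≥ 1`, so the subtraction is not truncated, and the normalized
  -- Hausdorff measure on the hyperplane is Lebesgue measure.
  have hrank : Module.finrank ℝ (ℝ ∙ e)ᗮ = n - 1 := by
    have h1 := (ℝ ∙ e).finrank_add_finrank_orthogonal
    rw [finrank_span_singleton (by rintro rfl; simp at he), finrank_euclideanSpace_fin] at h1
    omega
  have hvol : (μHE[n - 1] : Measure (ℝ ∙ e)ᗮ) = volume := by
    rw [← hrank]
    exact InnerProductSpace.euclideanHausdorffMeasure_eq_volume
  refine ⟨((1 + L : ℝ≥0) : ℝ≥0∞) ^ (n - 1) * ENNReal.ofReal (1 / h + 1),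
    ENNReal.mul_ne_top (ENNReal.pow_ne_top ENNReal.coe_ne_top) ENNReal.ofReal_ne_top,
    fun φ hφ => ?_⟩
  have hD : Continuous (fderiv ℝ φ) := hφ.continuous_fderiv (by norm_num)
  set f : EuclideanSpace ℝ (Fin n) → ℝ≥0∞ := fun x => ‖φ x‖ₑ ^ 2 + ‖fderiv ℝ φ x‖ₑ ^ 2 with hf
  have hfm : Measurable f :=
    (hφ.continuous.enorm.measurable.pow_const 2).add (hD.enorm.measurable.pow_const 2)
  have hpt (y : (ℝ ∙ e)ᗮ) : ‖φ (F y)‖ₑ ^ 2 ≤ ENNReal.ofReal (1 / h + 1) *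
      ∫⁻ t in Ioc 0 h, f (y + (g y - t) • e) := by
    have hlin (t : ℝ) : HasDerivAt
        (fun t : ℝ => (y : EuclideanSpace ℝ (Fin n)) + (g y - t) • e) (-e) t := by
      simpa using (((hasDerivAt_id t).const_sub (g y)).smul_const e).const_add
        (y : EuclideanSpace ℝ (Fin n))
    have h1 := enorm_sq_le_lintegral_Ioc
      (a := fun t => φ (y + (g y - t) • e))
      (a' := fun t => fderiv ℝ φ (y + (g y - t) • e) (-e))
      (fun t => (hφ.differentiable (by norm_num) _).hasFDerivAt.comp_hasDerivAt t (hlin t))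
      ((hD.comp (by fun_prop)).clm_apply continuous_const) hh
    simp only [sub_zero] at h1
    refine h1.trans ?_
    gcongr with t
    refine add_le_add le_rfl (pow_le_pow_left' ?_ 2)
    refine (ContinuousLinearMap.le_opENorm _ _).trans ?_
    rw [enorm_neg, ← ofReal_norm e, he]
    simp
  have hslice (y : (ℝ ∙ e)ᗮ) (hy : y ∈ W) :
      ∫⁻ t in Ioc 0 h, f (y + (g y - t) • e) ≤ ∫⁻ t : ℝ, U.indicator f (y + t • e) := by
    rw [← lintegral_indicator measurableSet_Ioc,
      ← lintegral_sub_left_eq_self (fun t : ℝ => U.indicator f (y + t • e)) (g y)]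
    refine lintegral_mono fun t => ?_
    by_cases ht : t ∈ Ioc 0 h
    · rw [indicator_of_mem ht, indicator_of_mem (hWU y hy t ht)]
    · simp [ht]
  calc ∫⁻ x in F '' W, ‖φ x‖ₑ ^ 2 ∂μHE[n - 1]
      ≤ ((1 + L : ℝ≥0) : ℝ≥0∞) ^ (n - 1) * ∫⁻ y in W, ‖φ (F y)‖ₑ ^ 2 := by
        rw [← hvol]
        exact lintegral_image_euclideanHausdorffMeasure_le hF _ W
          (hφ.continuous.enorm.measurable.pow_const 2)
    _ ≤ ((1 + L : ℝ≥0) : ℝ≥0∞) ^ (n - 1) * ∫⁻ y in W, ENNReal.ofReal (1 / h + 1) *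
          ∫⁻ t : ℝ, U.indicator f (y + t • e) := by
        exact mul_le_mul_right (setLIntegral_mono' hW fun y hy =>
          (hpt y).trans (mul_le_mul_right (hslice y hy) _)) _
    _ ≤ ((1 + L : ℝ≥0) : ℝ≥0∞) ^ (n - 1) * ∫⁻ y : (ℝ ∙ e)ᗮ, ENNReal.ofReal (1 / h + 1) *
          ∫⁻ t : ℝ, U.indicator f (y + t • e) := by
        gcongr
        exact Measure.restrict_le_self
    _ = _ := by
        rw [lintegral_const_mul' _ _ ENNReal.ofReal_ne_top, ← lintegral_indicator hU,
          lintegral_eq_lintegral_orthogonal he (hfm.indicator hU), mul_assoc]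

/-- Trace inequality for a Lipschitz domain with a closed set removed. -/
theorem traceOn_frontier (hΩ : IsOpen Ω) (hb : Bornology.IsBounded Ω)
    (hlip : HasLipschitzBoundary Ω) (hK : IsClosed K) (hKΩ : K ⊆ Ω) :
    TraceOn (Ω \ K) (frontier Ω) := by
  have hcomp : IsCompact (frontier Ω) :=
    hb.isCompact_closure.of_isClosed_subset isClosed_frontier frontier_subset_closure
  have hmono {s t : Set (EuclideanSpace ℝ (Fin n))} (hst : s ⊆ t) (h : TraceOn (Ω \ K) t) :
      TraceOn (Ω \ K) s := by
    obtain ⟨C, hC, h⟩ := h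
    exact ⟨C, hC, fun φ hφ => (lintegral_mono_set hst).trans (h φ hφ)⟩
  have hmain : TraceOn (Ω \ K) (frontier Ω ∩ frontier Ω) := by
    refine hcomp.induction_on (p := fun s => TraceOn (Ω \ K) (s ∩ frontier Ω)) ?_ ?_ ?_ ?_
    · exact ⟨0, by simp, by simp⟩
    · exact fun s t hst h => hmono (inter_subset_inter_left _ hst) h
    · rintro s t ⟨C, hC, hs⟩ ⟨D, hD, ht⟩
      refine ⟨C + D, by simp [hC, hD], fun φ hφ => ?_⟩
      rw [union_inter_distrib_right, add_mul]
      exact (lintegral_union_le _ _ _).trans (add_le_add (hs φ hφ) (ht φ hφ))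
    intro p hp
    obtain ⟨e, he, L, g, hg, δ₀, hδ₀, h₀⟩ := hlip p hp
    have hpK : p ∉ K := fun h => by
      rw [hΩ.frontier_eq] at hp
      exact hp.2 (hKΩ h)
    -- Shrinking the chart away from `K` puts the strip below the graph in `Ω \ K`. The resulting
    -- constant depends on `K`.
    obtain ⟨δ₁, hδ₁, hKball⟩ := Metric.isOpen_iff.1 hK.isOpen_compl p hpK
    obtain ⟨δ, hδ, hδδ₀, hδδ₁⟩ : ∃ δ > 0, δ ≤ δ₀ ∧ δ ≤ δ₁ :=
      ⟨min δ₀ δ₁, lt_min hδ₀ hδ₁, min_le_left _ _, min_le_right _ _⟩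
    have h : ∀ x ∈ Metric.ball p δ, (x ∈ Ω ↔ inner ℝ x e < g (x - inner ℝ x e • e)) :=
      fun x hx => h₀ x (Metric.ball_subset_ball hδδ₀ hx)
    have hpe := inner_eq_of_mem_frontier hΩ hg.continuous h (Metric.mem_ball_self hδ) hp
    have hL : (0 : ℝ) ≤ L := L.2
    -- The three terms bound the horizontal displacement, the variation of `g`, and the depth of the
    -- strip.
    obtain ⟨η, hη, hηδ⟩ : ∃ η : ℝ, 0 < η ∧ η + L * η + η < δ := by
      refine ⟨δ / (3 + L), by positivity, ?_⟩
      have : δ / (3 + L) * (3 + L) = δ := div_mul_cancel₀ _ (by positivity)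
      have : 0 < δ / (3 + L) := by positivity
      nlinarith
    set p' := p - inner ℝ p e • e with hp'
    set W : Set (ℝ ∙ e)ᗮ := {y | ‖(y : EuclideanSpace ℝ (Fin n)) - p'‖ < η} with hW
    have hWm : MeasurableSet W := (isOpen_lt (by fun_prop) continuous_const).measurableSet
    have hgraph := traceOn_graph (MeasurableSet.diff hΩ.measurableSet hK.measurableSet)
      he hg hη hWm ?_
    · refine ⟨Metric.ball p η, mem_nhdsWithin_of_mem_nhds (Metric.ball_mem_nhds p hη),
        hmono ?_ hgraph⟩
      rintro q ⟨hq, hqf⟩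
      have hqδ : q ∈ Metric.ball p δ :=
        Metric.ball_subset_ball (by nlinarith [mul_nonneg hL hη.le]) hq
      have hqe := inner_eq_of_mem_frontier hΩ hg.continuous h hqδ hqf
      refine ⟨⟨q - inner ℝ q e • e, ?_⟩, ?_, ?_⟩
      · rw [Submodule.mem_orthogonal_singleton_iff_inner_left, inner_sub_smul_self he, sub_self]
      · rw [Metric.mem_ball, dist_eq_norm] at hq
        refine lt_of_le_of_lt (le_of_eq_of_le ?_ (norm_sub_inner_smul_le he (q - p))) hq
        have : inner ℝ (q - p) e = inner ℝ q e - inner ℝ p e := inner_sub_left _ _ _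
        change ‖(q - inner ℝ q e • e) - (p - inner ℝ p e • e)‖ = _
        rw [this, sub_smul, sub_sub_sub_comm]
      · simp only
        rw [← hqe]
        abel
    · intro y hy t ht
      have hye : inner ℝ (y : EuclideanSpace ℝ (Fin n)) e = 0 :=
        Submodule.mem_orthogonal_singleton_iff_inner_left.1 y.2
      set z := (y : EuclideanSpace ℝ (Fin n)) + (g y - t) • e with hz
      have hze : inner ℝ z e = g y - t := by
        rw [hz, inner_add_left, hye, inner_smul_left, real_inner_self_eq_norm_sq, he]
        simp
      have hzδ : z ∈ Metric.ball p δ := by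
        rw [Metric.mem_ball, dist_eq_norm]
        have hp2 : p = p' + g p' • e := by rw [← hpe, hp']; abel
        have : z - p = ((y : EuclideanSpace ℝ (Fin n)) - p') + ((g y - g p') - t) • e := by
          conv_lhs => rw [hz, hp2]
          module
        rw [this]
        refine (norm_add_le _ _).trans_lt ?_
        rw [norm_smul, he, mul_one, Real.norm_eq_abs]
        have h1 : |g y - g p'| ≤ L * ‖(y : EuclideanSpace ℝ (Fin n)) - p'‖ := by
          simpa [Real.dist_eq, dist_eq_norm] using hg.dist_le_mul y p'
        have h2 : |g y - g p' - t| ≤ |g y - g p'| + |t| := abs_sub _ _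
        rw [abs_of_pos ht.1] at h2
        have hy' : ‖(y : EuclideanSpace ℝ (Fin n)) - p'‖ < η := hy
        have h3 : L * ‖(y : EuclideanSpace ℝ (Fin n)) - p'‖ ≤ L * η := by gcongr
        linarith [ht.2]
      refine ⟨(h z hzδ).2 ?_, hKball (Metric.ball_subset_ball hδδ₁ hzδ)⟩
      have hzy : z - inner ℝ z e • e = y := by rw [hze, hz]; abel
      rw [hzy, hze]
      linarith [ht.1]
  rwa [inter_self] at hmain

end TraceInequality

/-! ### Weak gradients: uniqueness, closedness, and the `H¹` norm. -/

section WeakGradient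

variable {n : ℕ} {Ω : Set (EuclideanSpace ℝ (Fin n))}

lemma memLp_restrict_of_continuous {F : Type*} [NormedAddCommGroup F]
    (hΩ : MeasurableSet Ω) (hb : Bornology.IsBounded Ω) {f : EuclideanSpace ℝ (Fin n) → F}
    (hf : Continuous f) (p : ℝ≥0∞) : MemLp f p (volume.restrict Ω) := by
  have : IsFiniteMeasure (volume.restrict Ω) := ⟨by simpa using hb.measure_lt_top⟩
  obtain ⟨C, hC⟩ := hb.isCompact_closure.exists_bound_of_continuousOn hf.continuousOn
  exact MemLp.of_bound hf.aestronglyMeasurable C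
    (ae_restrict_of_forall_mem hΩ fun x hx => hC x (subset_closure hx))

lemma continuous_gradient {φ : EuclideanSpace ℝ (Fin n) → ℝ} (hφ : ContDiff ℝ 1 φ) :
    Continuous (∇ φ) :=
  (InnerProductSpace.toDual ℝ _).symm.continuous.comp (hφ.continuous_fderiv (by norm_num))

lemma enorm_gradient (φ : EuclideanSpace ℝ (Fin n) → ℝ) (x : EuclideanSpace ℝ (Fin n)) :
    ‖∇ φ x‖ₑ = ‖fderiv ℝ φ x‖ₑ := by
  rw [← ofReal_norm, ← ofReal_norm, gradient, LinearIsometryEquiv.norm_map]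

lemma eLpNorm_two_sq {α F : Type*} [MeasurableSpace α] [NormedAddCommGroup F] (f : α → F)
    (μ : Measure α) : eLpNorm f 2 μ ^ 2 = ∫⁻ x, ‖f x‖ₑ ^ 2 ∂μ := by
  simpa using eLpNorm_nnreal_pow_eq_lintegral (f := f) (μ := μ) (p := 2) (by norm_num)

lemma IsTestFunction.contDiff_one {φ : EuclideanSpace ℝ (Fin n) → ℝ} (hφ : IsTestFunction φ) :
    ContDiff ℝ 1 φ := hφ.1.of_le (by exact_mod_cast le_top)

lemma gradient_eq_zero_of_notMem_tsupport {φ : EuclideanSpace ℝ (Fin n) → ℝ}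
    {x : EuclideanSpace ℝ (Fin n)} (hx : x ∉ tsupport φ) : ∇ φ x = 0 := by
  have : fderiv ℝ φ x = 0 := by
    by_contra h
    exact hx (support_fderiv_subset ℝ h)
  rw [gradient, this, map_zero]

/-- The classical gradient of a `C¹` function is a weak gradient. -/
lemma hasL2WeakGradient_of_contDiff (hΩ : MeasurableSet Ω) (hb : Bornology.IsBounded Ω)
    {u : EuclideanSpace ℝ (Fin n) → ℝ} (hu : ContDiff ℝ 1 u) : HasL2WeakGradient Ω u (∇ u) where
  memLp := memLp_restrict_of_continuous hΩ hb hu.continuous 2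
  memLp_grad := memLp_restrict_of_continuous hΩ hb (continuous_gradient hu) 2
  integral_eq φ hφ hsupp := by
    have hφ1 := hφ.contDiff_one
    have hgc : HasCompactSupport (∇ φ) :=
      HasCompactSupport.intro hφ.2 fun x hx => gradient_eq_zero_of_notMem_tsupport hx
    have hi1 : Integrable fun x => u x • ∇ φ x :=
      (hu.continuous.smul (continuous_gradient hφ1)).integrable_of_hasCompactSupport
        hgc.smul_left
    have hi2 : Integrable fun x => φ x • ∇ u x :=
      (hφ1.continuous.smul (continuous_gradient hu)).integrable_of_hasCompactSupport
        hφ.2.smul_right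
    rw [setIntegral_eq_integral_of_forall_compl_eq_zero,
      setIntegral_eq_integral_of_forall_compl_eq_zero]
    -- Pairing with a fixed vector turns the vector identity into a scalar integration by parts for
    -- directional derivatives.
    · refine ext_inner_left ℝ fun v => ?_
      rw [inner_neg_right, ← integral_inner hi1, ← integral_inner hi2]
      simp only [inner_smul_right, inner_gradient_right, conj_trivial]
      have hD1 : Continuous fun x => fderiv ℝ u x v :=
        (hu.continuous_fderiv (by norm_num)).clm_apply continuous_const
      have hD2 : Continuous fun x => fderiv ℝ φ x v :=
        (hφ1.continuous_fderiv (by norm_num)).clm_apply continuous_const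
      have hDc : HasCompactSupport fun x => fderiv ℝ φ x v := hφ.2.fderiv_apply ℝ v
      rw [integral_mul_fderiv_eq_neg_fderiv_mul_of_integrable]
      · simp only [mul_comm]
      · exact (hD1.mul hφ1.continuous).integrable_of_hasCompactSupport hφ.2.mul_left
      · exact (hu.continuous.mul hD2).integrable_of_hasCompactSupport hDc.mul_left
      · exact (hu.continuous.mul hφ1.continuous).integrable_of_hasCompactSupport hφ.2.mul_left
      · exact fun x _ => hu.differentiable (by norm_num) x
      · exact fun x _ => hφ1.differentiable (by norm_num) x
    · intro x hx
      rw [image_eq_zero_of_notMem_tsupport fun h => hx (hsupp h), zero_smul]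
    · intro x hx
      rw [gradient_eq_zero_of_notMem_tsupport fun h => hx (hsupp h), smul_zero]

lemma HasL2WeakGradient.integrable_smul_gradient {u : EuclideanSpace ℝ (Fin n) → ℝ}
    {G : EuclideanSpace ℝ (Fin n) → EuclideanSpace ℝ (Fin n)} (hΩ : MeasurableSet Ω)
    (hb : Bornology.IsBounded Ω) (h : HasL2WeakGradient Ω u G)
    {φ : EuclideanSpace ℝ (Fin n) → ℝ} (hφ : IsTestFunction φ) :
    IntegrableOn (fun x => u x • ∇ φ x) Ω := by
  rw [IntegrableOn, ← memLp_one_iff_integrable]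
  exact (memLp_restrict_of_continuous hΩ hb (continuous_gradient hφ.contDiff_one) 2).smul h.memLp

lemma HasL2WeakGradient.integrable_smul_grad {u : EuclideanSpace ℝ (Fin n) → ℝ}
    {G : EuclideanSpace ℝ (Fin n) → EuclideanSpace ℝ (Fin n)} (hΩ : MeasurableSet Ω)
    (hb : Bornology.IsBounded Ω) (h : HasL2WeakGradient Ω u G)
    {φ : EuclideanSpace ℝ (Fin n) → ℝ} (hφ : IsTestFunction φ) :
    IntegrableOn (fun x => φ x • G x) Ω := by
  rw [IntegrableOn, ← memLp_one_iff_integrable]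
  exact h.memLp_grad.smul (memLp_restrict_of_continuous hΩ hb hφ.contDiff_one.continuous 2)

lemma HasL2WeakGradient.sub {u v : EuclideanSpace ℝ (Fin n) → ℝ}
    {G H : EuclideanSpace ℝ (Fin n) → EuclideanSpace ℝ (Fin n)} (hΩ : MeasurableSet Ω)
    (hb : Bornology.IsBounded Ω) (hu : HasL2WeakGradient Ω u G) (hv : HasL2WeakGradient Ω v H) :
    HasL2WeakGradient Ω (u - v) (G - H) where
  memLp := hu.memLp.sub hv.memLp
  memLp_grad := hu.memLp_grad.sub hv.memLp_grad
  integral_eq φ hφ hsupp := by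
    simp only [Pi.sub_apply, sub_smul, smul_sub]
    rw [integral_sub (hu.integrable_smul_gradient hΩ hb hφ) (hv.integrable_smul_gradient hΩ hb hφ),
      integral_sub (hu.integrable_smul_grad hΩ hb hφ) (hv.integrable_smul_grad hΩ hb hφ),
      hu.integral_eq φ hφ hsupp, hv.integral_eq φ hφ hsupp]
    abel

lemma HasL2WeakGradient.congr {u v : EuclideanSpace ℝ (Fin n) → ℝ}
    {G H : EuclideanSpace ℝ (Fin n) → EuclideanSpace ℝ (Fin n)}
    (hu : HasL2WeakGradient Ω u G) (huv : u =ᵐ[volume.restrict Ω] v)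
    (hGH : G =ᵐ[volume.restrict Ω] H) : HasL2WeakGradient Ω v H where
  memLp := hu.memLp.ae_eq huv
  memLp_grad := hu.memLp_grad.ae_eq hGH
  integral_eq φ hφ hsupp := by
    have h1 : ∫ x in Ω, v x • ∇ φ x = ∫ x in Ω, u x • ∇ φ x :=
      integral_congr_ae (by filter_upwards [huv] with x hx; rw [hx])
    have h2 : ∫ x in Ω, φ x • H x = ∫ x in Ω, φ x • G x :=
      integral_congr_ae (by filter_upwards [hGH] with x hx; rw [hx])
    rw [h1, h2, hu.integral_eq φ hφ hsupp]

/-- Weak gradients are unique up to null sets. -/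
lemma HasL2WeakGradient.ae_unique {u : EuclideanSpace ℝ (Fin n) → ℝ}
    {G H : EuclideanSpace ℝ (Fin n) → EuclideanSpace ℝ (Fin n)} (hΩ : IsOpen Ω)
    (hb : Bornology.IsBounded Ω) (hG : HasL2WeakGradient Ω u G) (hH : HasL2WeakGradient Ω u H) :
    G =ᵐ[volume.restrict Ω] H := by
  have : IsFiniteMeasure (volume.restrict Ω) := ⟨by simpa using hb.measure_lt_top⟩
  have hloc : LocallyIntegrableOn (G - H) Ω volume :=
    IntegrableOn.locallyIntegrableOn ((hG.memLp_grad.sub hH.memLp_grad).integrable (by norm_num))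
  have h := hΩ.ae_eq_zero_of_integral_contDiff_smul_eq_zero hloc fun φ hφ hφc hsupp => by
    have hφt : IsTestFunction φ := ⟨hφ, hφc⟩
    rw [← setIntegral_eq_integral_of_forall_compl_eq_zero (s := Ω)]
    · simp only [Pi.sub_apply, smul_sub]
      rw [integral_sub (hG.integrable_smul_grad hΩ.measurableSet hb hφt)
        (hH.integrable_smul_grad hΩ.measurableSet hb hφt), sub_eq_zero]
      exact neg_injective ((hG.integral_eq φ hφt hsupp).symm.trans (hH.integral_eq φ hφt hsupp))
    · intro x hx
      rw [image_eq_zero_of_notMem_tsupport fun h => hx (hsupp h), zero_smul]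
  rw [Filter.EventuallyEq, ae_restrict_iff' hΩ.measurableSet]
  filter_upwards [h] with x hx hxΩ
  exact sub_eq_zero.1 (hx hxΩ)

/-- The space of functions with a weak gradient is closed. -/
lemma HasL2WeakGradient.of_approx (hΩ : MeasurableSet Ω) (hb : Bornology.IsBounded Ω)
    {u : EuclideanSpace ℝ (Fin n) → ℝ}
    {G : EuclideanSpace ℝ (Fin n) → EuclideanSpace ℝ (Fin n)}
    (hu : MemLp u 2 (volume.restrict Ω)) (hG : MemLp G 2 (volume.restrict Ω))
    (h : ∀ ε : ℝ≥0∞, 0 < ε → ∃ v H, HasL2WeakGradient Ω v H ∧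
      eLpNorm (u - v) 2 (volume.restrict Ω) ≤ ε ∧ eLpNorm (G - H) 2 (volume.restrict Ω) ≤ ε) :
    HasL2WeakGradient Ω u G := by
  refine ⟨hu, hG, fun φ hφ hsupp => ?_⟩
  have hLφ := memLp_restrict_of_continuous hΩ hb hφ.contDiff_one.continuous 2
  have hLD := memLp_restrict_of_continuous hΩ hb (continuous_gradient hφ.contDiff_one) 2
  have hi1 : IntegrableOn (fun x => u x • ∇ φ x) Ω := by
    rw [IntegrableOn, ← memLp_one_iff_integrable]; exact hLD.smul hu
  have hi2 : IntegrableOn (fun x => φ x • G x) Ω := by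
    rw [IntegrableOn, ← memLp_one_iff_integrable]; exact hG.smul hLφ
  rw [← sub_eq_zero, sub_neg_eq_add, ← enorm_eq_zero]
  set M := eLpNorm (∇ φ) 2 (volume.restrict Ω) + eLpNorm φ 2 (volume.restrict Ω) with hM
  have hMt : M ≠ ⊤ := ENNReal.add_ne_top.2 ⟨hLD.eLpNorm_ne_top, hLφ.eLpNorm_ne_top⟩
  -- The integration-by-parts defect is linear and vanishes for `(v, H)`. It is thus that of `(u -
  -- v, G - H)`, which Hölder bounds by `ε * M`.
  have hbound (ε : ℝ≥0∞) (hε : 0 < ε) :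
      ‖(∫ x in Ω, u x • ∇ φ x) + ∫ x in Ω, φ x • G x‖ₑ ≤ ε * M := by
    obtain ⟨v, H, hv, h1, h2⟩ := h ε hε
    have e1 : (∫ x in Ω, u x • ∇ φ x) + ∫ x in Ω, φ x • G x =
        (∫ x in Ω, ((u - v) • ∇ φ) x) + ∫ x in Ω, (φ • (G - H)) x := by
      simp only [Pi.smul_apply', Pi.sub_apply, sub_smul, smul_sub]
      rw [integral_sub hi1 (hv.integrable_smul_gradient hΩ hb hφ),
        integral_sub hi2 (hv.integrable_smul_grad hΩ hb hφ), hv.integral_eq φ hφ hsupp]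
      abel
    rw [e1]
    refine (enorm_add_le _ _).trans ?_
    rw [hM, mul_add]
    refine add_le_add ?_ ?_
    · refine (enorm_integral_le_lintegral_enorm _).trans ?_
      rw [← eLpNorm_one_eq_lintegral_enorm]
      refine (eLpNorm_smul_le_mul_eLpNorm (p := 2) (q := 2) hLD.1 (hu.sub hv.memLp).1).trans ?_
      gcongr
    · refine (enorm_integral_le_lintegral_enorm _).trans ?_
      rw [← eLpNorm_one_eq_lintegral_enorm]
      refine (eLpNorm_smul_le_mul_eLpNorm (p := 2) (q := 2) (hG.sub hv.memLp_grad).1 hLφ.1).trans ?_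
      rw [mul_comm]
      gcongr
  by_contra hne
  obtain ⟨ε, hε, hεM⟩ := ENNReal.exists_pos_mul_lt hMt hne
  exact absurd (hbound ε hε) (not_le.2 hεM)

lemma MemH1.hasL2WeakGradient {u : EuclideanSpace ℝ (Fin n) → ℝ} (h : MemH1 Ω u) :
    HasL2WeakGradient Ω u (weakGrad Ω u) := by
  rw [weakGrad, dif_pos h]
  exact h.choose_spec

lemma HasL2WeakGradient.memH1 {u : EuclideanSpace ℝ (Fin n) → ℝ}
    {G : EuclideanSpace ℝ (Fin n) → EuclideanSpace ℝ (Fin n)} (h : HasL2WeakGradient Ω u G) :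
    MemH1 Ω u := ⟨G, h⟩

lemma HasL2WeakGradient.weakGrad_ae_eq {u : EuclideanSpace ℝ (Fin n) → ℝ}
    {G : EuclideanSpace ℝ (Fin n) → EuclideanSpace ℝ (Fin n)} (hΩ : IsOpen Ω)
    (hb : Bornology.IsBounded Ω) (h : HasL2WeakGradient Ω u G) :
    weakGrad Ω u =ᵐ[volume.restrict Ω] G :=
  h.memH1.hasL2WeakGradient.ae_unique hΩ hb h

lemma MemH1.sub {u v : EuclideanSpace ℝ (Fin n) → ℝ} (hΩ : MeasurableSet Ω)
    (hb : Bornology.IsBounded Ω) (hu : MemH1 Ω u) (hv : MemH1 Ω v) : MemH1 Ω (u - v) :=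
  (hu.hasL2WeakGradient.sub hΩ hb hv.hasL2WeakGradient).memH1

lemma memH1_of_contDiff (hΩ : MeasurableSet Ω) (hb : Bornology.IsBounded Ω)
    {u : EuclideanSpace ℝ (Fin n) → ℝ} (hu : ContDiff ℝ 1 u) : MemH1 Ω u :=
  (hasL2WeakGradient_of_contDiff hΩ hb hu).memH1

lemma HasL2WeakGradient.h1Norm_eq {u : EuclideanSpace ℝ (Fin n) → ℝ}
    {G : EuclideanSpace ℝ (Fin n) → EuclideanSpace ℝ (Fin n)} (hΩ : IsOpen Ω)
    (hb : Bornology.IsBounded Ω) (h : HasL2WeakGradient Ω u G) :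
    h1Norm Ω u = (eLpNorm u 2 (volume.restrict Ω) ^ 2 +
      eLpNorm G 2 (volume.restrict Ω) ^ 2) ^ (1 / 2 : ℝ) := by
  rw [h1Norm, eLpNorm_congr_ae (h.weakGrad_ae_eq hΩ hb)]

lemma sq_rpow_half (a : ℝ≥0∞) : (a ^ 2) ^ (1 / 2 : ℝ) = a := by
  rw [← ENNReal.rpow_natCast, ← ENNReal.rpow_mul]
  simp

lemma eLpNorm_le_h1Norm (Ω : Set (EuclideanSpace ℝ (Fin n))) (u : EuclideanSpace ℝ (Fin n) → ℝ) :
    eLpNorm u 2 (volume.restrict Ω) ≤ h1Norm Ω u := by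
  conv_lhs => rw [← sq_rpow_half (eLpNorm _ _ _)]
  exact ENNReal.rpow_le_rpow le_self_add (by norm_num)

lemma eLpNorm_weakGrad_le_h1Norm (Ω : Set (EuclideanSpace ℝ (Fin n)))
    (u : EuclideanSpace ℝ (Fin n) → ℝ) :
    eLpNorm (weakGrad Ω u) 2 (volume.restrict Ω) ≤ h1Norm Ω u := by
  conv_lhs => rw [← sq_rpow_half (eLpNorm _ _ _)]
  exact ENNReal.rpow_le_rpow le_add_self (by norm_num)

lemma h1Norm_le_add (Ω : Set (EuclideanSpace ℝ (Fin n))) (u : EuclideanSpace ℝ (Fin n) → ℝ) :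
    h1Norm Ω u ≤ eLpNorm u 2 (volume.restrict Ω) +
      eLpNorm (weakGrad Ω u) 2 (volume.restrict Ω) := by
  conv_rhs => rw [← sq_rpow_half (eLpNorm u _ _ + _)]
  refine ENNReal.rpow_le_rpow ?_ (by norm_num)
  rw [add_sq]
  gcongr
  exact le_self_add

/-- The factor `2` comes from comparing the Hilbert norm with the sum of two `L²` norms. It is
harmless, since only finiteness of constants matters later. -/
lemma h1Norm_sub_le (hΩ : IsOpen Ω) (hb : Bornology.IsBounded Ω)
    {u v w : EuclideanSpace ℝ (Fin n) → ℝ} (hu : MemH1 Ω u) (hv : MemH1 Ω v) (hw : MemH1 Ω w) :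
    h1Norm Ω (v - w) ≤ 2 * (h1Norm Ω (u - v) + h1Norm Ω (u - w)) := by
  have hv' := hu.hasL2WeakGradient.sub hΩ.measurableSet hb hv.hasL2WeakGradient
  have hw' := hu.hasL2WeakGradient.sub hΩ.measurableSet hb hw.hasL2WeakGradient
  have hvw := hw'.sub hΩ.measurableSet hb hv'
  rw [sub_sub_sub_cancel_left, sub_sub_sub_cancel_left] at hvw
  refine (h1Norm_le_add Ω _).trans ?_
  rw [eLpNorm_congr_ae (hvw.weakGrad_ae_eq hΩ hb), two_mul]
  refine add_le_add ?_ ?_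
  · rw [← sub_sub_sub_cancel_left w v u, add_comm]
    refine (eLpNorm_sub_le hw'.memLp.1 hv'.memLp.1 (by norm_num)).trans ?_
    gcongr <;> exact eLpNorm_le_h1Norm _ _
  · rw [← sub_sub_sub_cancel_left _ _ (weakGrad Ω u), add_comm]
    refine (eLpNorm_sub_le hw'.memLp_grad.1 hv'.memLp_grad.1 (by norm_num)).trans ?_
    rw [← eLpNorm_congr_ae (hw'.weakGrad_ae_eq hΩ hb),
      ← eLpNorm_congr_ae (hv'.weakGrad_ae_eq hΩ hb)]
    gcongr <;> exact eLpNorm_weakGrad_le_h1Norm _ _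

end WeakGradient

/-! ### Traces: stability and uniqueness. -/

section Trace

variable {n : ℕ} {U Γ : Set (EuclideanSpace ℝ (Fin n))}

lemma lintegral_sq_le_mul_to_eLpNorm {α β F G : Type*} [MeasurableSpace α] [MeasurableSpace β]
    [NormedAddCommGroup F] [NormedAddCommGroup G] {μ : Measure α} {ν : Measure β} {f : α → F}
    {g : β → G} {C : ℝ≥0∞} (h : ∫⁻ x, ‖f x‖ₑ ^ 2 ∂μ ≤ C * ∫⁻ x, ‖g x‖ₑ ^ 2 ∂ν) :
    eLpNorm f 2 μ ≤ C ^ (1 / 2 : ℝ) * eLpNorm g 2 ν := by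
  rw [← eLpNorm_two_sq, ← eLpNorm_two_sq] at h
  have := ENNReal.rpow_le_rpow h (z := 1 / 2) (by norm_num)
  rwa [ENNReal.mul_rpow_of_nonneg _ _ (by norm_num), sq_rpow_half, sq_rpow_half] at this

lemma TraceOn.eLpNorm_le (h : TraceOn U Γ) (hU : IsOpen U) (hb : Bornology.IsBounded U) :
    ∃ C : ℝ≥0∞, C ≠ ⊤ ∧ ∀ φ : EuclideanSpace ℝ (Fin n) → ℝ, ContDiff ℝ 1 φ →
      eLpNorm φ 2 (surfaceMeasure Γ) ≤ C * h1Norm U φ := by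
  obtain ⟨C, hC, h⟩ := h
  refine ⟨C ^ (1 / 2 : ℝ), ENNReal.rpow_ne_top_of_nonneg (by norm_num) hC, fun φ hφ => ?_⟩
  have h1 := h φ hφ
  rw [lintegral_add_left (hφ.continuous.enorm.measurable.pow_const 2), ← eLpNorm_two_sq,
    ← eLpNorm_two_sq] at h1
  simp_rw [← enorm_gradient] at h1
  rw [← eLpNorm_two_sq] at h1
  have := ENNReal.rpow_le_rpow h1 (z := 1 / 2) (by norm_num)
  rwa [ENNReal.mul_rpow_of_nonneg _ _ (by norm_num), sq_rpow_half,
    ← (hasL2WeakGradient_of_contDiff hU.measurableSet hb hφ).h1Norm_eq hU hb] at this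

/-- The trace inequality for differences of a function with a trace and a smooth function. -/
lemma TraceOn.eLpNorm_trace_sub_le (h : TraceOn U Γ) (hU : IsOpen U)
    (hb : Bornology.IsBounded U) :
    ∃ C : ℝ≥0∞, C ≠ ⊤ ∧ ∀ u T, IsTrace U Γ u T → ∀ ψ : EuclideanSpace ℝ (Fin n) → ℝ,
      ContDiff ℝ 1 ψ → eLpNorm (T - ψ) 2 (surfaceMeasure Γ) ≤ C * h1Norm U (u - ψ) := by
  obtain ⟨C, hC, h⟩ := h.eLpNorm_le hU hb
  refine ⟨C * 2, ENNReal.mul_ne_top hC (by simp), fun u T hT ψ hψ => ?_⟩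
  have hψ1 := memH1_of_contDiff hU.measurableSet hb hψ
  have hb1 (ε : ℝ≥0∞) (hε : 0 < ε) : eLpNorm (T - ψ) 2 (surfaceMeasure Γ) ≤
      C * 2 * h1Norm U (u - ψ) + ε * (1 + C * 2) := by
    obtain ⟨φ, hφ, h1, h2⟩ := hT.2.2 ε hε
    have hφ1 := memH1_of_contDiff hU.measurableSet hb hφ.contDiff_one
    calc eLpNorm (T - ψ) 2 (surfaceMeasure Γ)
        = eLpNorm ((T - φ) + (φ - ψ)) 2 (surfaceMeasure Γ) := by rw [sub_add_sub_cancel]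
      _ ≤ eLpNorm (T - φ) 2 (surfaceMeasure Γ) + eLpNorm (φ - ψ) 2 (surfaceMeasure Γ) :=
          eLpNorm_add_le (hT.2.1.1.sub hφ.contDiff_one.continuous.aestronglyMeasurable)
            (hφ.contDiff_one.continuous.sub hψ.continuous).aestronglyMeasurable (by norm_num)
      _ ≤ ε + C * (2 * (ε + h1Norm U (u - ψ))) := by
          refine add_le_add h2.le ((h _ (hφ.contDiff_one.sub hψ)).trans ?_)
          refine mul_le_mul_right ((h1Norm_sub_le hU hb hT.1 hφ1 hψ1).trans ?_) _
          gcongr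
      _ = _ := by ring
  refine ENNReal.le_of_forall_pos_le_add fun δ hδ _ => ?_
  obtain ⟨ε, hε, hεM⟩ := ENNReal.exists_pos_mul_lt (a := 1 + C * 2) (b := δ)
    (ENNReal.add_ne_top.2 ⟨by simp, ENNReal.mul_ne_top hC (by simp)⟩) (by simpa using hδ.ne')
  exact (hb1 ε hε).trans (by gcongr)

/-- Traces are unique up to null sets. -/
lemma IsTrace.ae_unique (h : TraceOn U Γ) (hU : IsOpen U) (hb : Bornology.IsBounded U)
    {u T T' : EuclideanSpace ℝ (Fin n) → ℝ} (hT : IsTrace U Γ u T) (hT' : IsTrace U Γ u T') :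
    T =ᵐ[surfaceMeasure Γ] T' := by
  obtain ⟨C, hC, h⟩ := h.eLpNorm_trace_sub_le hU hb
  have h0 : eLpNorm (T - T') 2 (surfaceMeasure Γ) = 0 := by
    by_contra hne
    obtain ⟨ε, hε, hεM⟩ := ENNReal.exists_pos_mul_lt (a := C + C)
      (ENNReal.add_ne_top.2 ⟨hC, hC⟩) hne
    obtain ⟨φ, hφ, h1, -⟩ := hT.2.2 ε hε
    have hφc := hφ.contDiff_one.continuous.aestronglyMeasurable (μ := surfaceMeasure Γ)
    refine absurd ?_ (not_le.2 hεM)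
    calc eLpNorm (T - T') 2 (surfaceMeasure Γ)
        = eLpNorm ((T - φ) - (T' - φ)) 2 (surfaceMeasure Γ) := by rw [sub_sub_sub_cancel_right]
      _ ≤ eLpNorm (T - φ) 2 (surfaceMeasure Γ) + eLpNorm (T' - φ) 2 (surfaceMeasure Γ) :=
          eLpNorm_sub_le (hT.2.1.1.sub hφc) (hT'.2.1.1.sub hφc) (by norm_num)
      _ ≤ C * h1Norm U (u - φ) + C * h1Norm U (u - φ) :=
          add_le_add (h u T hT φ hφ.contDiff_one) (h u T' hT' φ hφ.contDiff_one)
      _ ≤ ε * (C + C) := by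
          rw [← add_mul, mul_comm]
          gcongr
  have := (eLpNorm_eq_zero_iff (hT.2.1.1.sub hT'.2.1.1) (by norm_num)).1 h0
  filter_upwards [this] with x hx
  exact sub_eq_zero.1 hx

lemma isTrace_trace {u : EuclideanSpace ℝ (Fin n) → ℝ} (h : ∃ T, IsTrace U Γ u T) :
    IsTrace U Γ u (trace U Γ u) := by
  rw [trace, dif_pos h]
  exact h.choose_spec

lemma IsTestFunction.isTrace_self {φ : EuclideanSpace ℝ (Fin n) → ℝ} (hφ : IsTestFunction φ)
    (hU : IsOpen U) (hb : Bornology.IsBounded U)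
    (hL : MemLp φ 2 (surfaceMeasure Γ)) : IsTrace U Γ φ φ := by
  have h := hasL2WeakGradient_of_contDiff hU.measurableSet hb hφ.contDiff_one
  refine ⟨h.memH1, hL, fun ε hε => ⟨φ, hφ, ?_, by simpa using hε⟩⟩
  have h0 := (h.sub hU.measurableSet hb h).h1Norm_eq hU hb
  rw [sub_self, sub_self] at h0
  rw [sub_self, h0]
  simpa using hε

end Trace

/-! ### Zero capacity of a point in dimension at least two. -/

section Cutoff

variable {n : ℕ}

/-- At most one term is nonzero, so squaring creates no cross terms. This makes the energy of a sum
of `N` cutoffs grow like `N` rather than `N²`. -/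
lemma enorm_sum_sq_le_of_pairwise {ι F : Type*} [NormedAddCommGroup F] (s : Finset ι) (f : ι → F)
    (h : ∀ i ∈ s, ∀ j ∈ s, i ≠ j → f i = 0 ∨ f j = 0) :
    ‖∑ i ∈ s, f i‖ₑ ^ 2 ≤ ∑ i ∈ s, ‖f i‖ₑ ^ 2 := by
  by_cases hz : ∀ i ∈ s, f i = 0
  · simp [Finset.sum_eq_zero hz]
  push Not at hz
  obtain ⟨i, hi, hfi⟩ := hz
  rw [Finset.sum_eq_single_of_mem i hi fun j hj hji => (h j hj i hi hji).resolve_right hfi]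
  exact Finset.single_le_sum (f := fun i => ‖f i‖ₑ ^ 2) (fun _ _ => zero_le) hi

/-- A smooth radial function vanishing in the unit ball and equal to `1` where `2 ≤ ‖x‖²`. -/
noncomputable def radialStep (x : EuclideanSpace ℝ (Fin n)) : ℝ :=
  Real.smoothTransition (‖x‖ ^ 2 - 1)

lemma contDiff_radialStep {m : ℕ∞} : ContDiff ℝ m (radialStep (n := n)) :=
  Real.smoothTransition.contDiff.comp ((contDiff_norm_sq ℝ).sub contDiff_const)

lemma radialStep_of_le {x : EuclideanSpace ℝ (Fin n)} (hx : ‖x‖ ^ 2 ≤ 1) : radialStep x = 0 :=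
  Real.smoothTransition.zero_of_nonpos (by linarith)

lemma radialStep_of_ge {x : EuclideanSpace ℝ (Fin n)} (hx : 2 ≤ ‖x‖ ^ 2) : radialStep x = 1 :=
  Real.smoothTransition.one_of_one_le (by linarith)

lemma fderiv_radialStep_of_lt {x : EuclideanSpace ℝ (Fin n)} (hx : ‖x‖ ^ 2 < 1) :
    fderiv ℝ (radialStep (n := n)) x = 0 := by
  have h : radialStep (n := n) =ᶠ[𝓝 x] fun _ => 0 := by
    filter_upwards [(continuous_norm.pow 2).continuousAt.eventually_lt_const hx] with y hy
    exact radialStep_of_le (le_of_lt hy)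
  rw [h.fderiv_eq, fderiv_fun_const, Pi.zero_apply]

lemma fderiv_radialStep_of_gt {x : EuclideanSpace ℝ (Fin n)} (hx : 2 < ‖x‖ ^ 2) :
    fderiv ℝ (radialStep (n := n)) x = 0 := by
  have h : radialStep (n := n) =ᶠ[𝓝 x] fun _ => 1 := by
    filter_upwards [(continuous_norm.pow 2).continuousAt.eventually_const_lt hx] with y hy
    exact radialStep_of_ge (le_of_lt hy)
  rw [h.fderiv_eq, fderiv_fun_const, Pi.zero_apply]

lemma exists_enorm_fderiv_radialStep_le (n : ℕ) :
    ∃ M : ℝ≥0∞, M ≠ ⊤ ∧ ∀ x, ‖fderiv ℝ (radialStep (n := n)) x‖ₑ ≤ M := by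
  have hc : HasCompactSupport (fderiv ℝ (radialStep (n := n))) := by
    refine HasCompactSupport.intro (isCompact_closedBall 0 2) fun x hx => ?_
    rw [mem_closedBall_zero_iff, not_le] at hx
    exact fderiv_radialStep_of_gt (by nlinarith)
  obtain ⟨C, hC⟩ := hc.exists_bound_of_continuous
    ((contDiff_radialStep (m := 1)).continuous_fderiv (by norm_num))
  refine ⟨ENNReal.ofReal C, ENNReal.ofReal_ne_top, fun x => ?_⟩
  rw [← ofReal_norm]
  exact ENNReal.ofReal_le_ofReal (hC x)

lemma fderiv_radialStep_smul (c : ℝ) (x : EuclideanSpace ℝ (Fin n)) :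
    fderiv ℝ (fun x => radialStep (n := n) (c • x)) x =
      c • fderiv ℝ (radialStep (n := n)) (c • x) := by
  rw [fderiv_comp_smul]

/-- The squared gradient scales like `c²` and lives in a ball of volume proportional to `(2 / c)^n`.
The product is bounded for `c ≥ 1` exactly because `n ≥ 2`; in the plane the energy is scale
invariant. -/
lemma lintegral_fderiv_radialStep_smul_le (hn : 2 ≤ n) :
    ∃ M : ℝ≥0∞, M ≠ ⊤ ∧ ∀ c : ℝ, 1 ≤ c →
      ∫⁻ x, ‖fderiv ℝ (fun x => radialStep (n := n) (c • x)) x‖ₑ ^ 2 ≤ M := by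
  obtain ⟨M, hM, h⟩ := exists_enorm_fderiv_radialStep_le n
  set B : ℝ≥0∞ := volume (Metric.ball (0 : EuclideanSpace ℝ (Fin n)) 1)
  refine ⟨M ^ 2 * (ENNReal.ofReal (2 ^ n) * B), ENNReal.mul_ne_top (ENNReal.pow_ne_top hM)
    (ENNReal.mul_ne_top ENNReal.ofReal_ne_top measure_ball_lt_top.ne), fun c hc => ?_⟩
  have hc0 : 0 < c := by linarith
  calc ∫⁻ x, ‖fderiv ℝ (fun x => radialStep (n := n) (c • x)) x‖ₑ ^ 2
      ≤ ∫⁻ x, (Metric.ball (0 : EuclideanSpace ℝ (Fin n)) (2 / c)).indicator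
          (fun _ => (ENNReal.ofReal c * M) ^ 2) x := by
        refine lintegral_mono fun x => ?_
        rw [fderiv_radialStep_smul, enorm_smul, Real.enorm_of_nonneg hc0.le]
        by_cases hx : x ∈ Metric.ball (0 : EuclideanSpace ℝ (Fin n)) (2 / c)
        · rw [indicator_of_mem hx]
          gcongr
          exact h _
        · rw [mem_ball_zero_iff, not_lt, div_le_iff₀ hc0] at hx
          have h0 : fderiv ℝ (radialStep (n := n)) (c • x) = 0 := by
            refine fderiv_radialStep_of_gt ?_
            rw [norm_smul, Real.norm_of_nonneg hc0.le]
            nlinarith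
          rw [← ofReal_norm (fderiv ℝ _ _), h0, norm_zero]
          simp
    _ = M ^ 2 * (ENNReal.ofReal (c ^ 2 * (2 / c) ^ n) * B) := by
        rw [lintegral_indicator Metric.isOpen_ball.measurableSet, setLIntegral_const,
          Measure.addHaar_ball_of_pos _ _ (by positivity), finrank_euclideanSpace_fin,
          ENNReal.ofReal_mul (by positivity), mul_pow, ENNReal.ofReal_pow hc0.le]
        ring
    _ ≤ _ := by
        gcongr
        rw [div_pow, mul_div_assoc', div_le_iff₀ (by positivity), mul_comm]
        gcongr

/-- Points have zero capacity in dimension at least two. -/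
lemma exists_cutoff (hn : 2 ≤ n) {ρ : ℝ} (hρ : 0 < ρ) {ε : ℝ≥0∞} (hε : 0 < ε) :
    ∃ w : EuclideanSpace ℝ (Fin n) → ℝ, ContDiff ℝ ∞ w ∧
      (∃ s > 0, ∀ x ∈ Metric.ball (0 : EuclideanSpace ℝ (Fin n)) s, w x = 0) ∧
      (∀ x : EuclideanSpace ℝ (Fin n), ρ ≤ ‖x‖ → w x = 1) ∧ ∫⁻ x, ‖fderiv ℝ w x‖ₑ ^ 2 < ε := by
  obtain ⟨M, hM, h⟩ := lintegral_fderiv_radialStep_smul_le hn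
  -- The average of `N` cutoffs with essentially disjoint gradients has energy at most `N⁻² · N · M
  -- = M / N`.
  obtain ⟨N, hN⟩ : ∃ N : ℕ, M / ε < N := by
    rcases eq_or_ne ε ⊤ with rfl | hεt
    · exact ⟨1, by simp⟩
    · exact ENNReal.exists_nat_gt (ENNReal.div_ne_top hM hε.ne')
  have hN0 : N ≠ 0 := by
    rintro rfl
    simp at hN
  have hNpos : (0 : ℝ) < N := by positivity
  -- The bound `2 / ρ` makes every cutoff equal to `1` outside radius `ρ`, and `1` is required by
  -- the scaling estimate. The gradient at scale `c k` lives where `1 ≤ c k * ‖x‖ ≤ √2`, so doubling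
  -- separates the annuli.
  set l : ℝ := max (2 / ρ) 1 with hl
  have hl1 : 1 ≤ l := le_max_right _ _
  set c : ℕ → ℝ := fun k => l * 2 ^ k with hc
  have hc1 (k : ℕ) : 1 ≤ c k := one_le_mul_of_one_le_of_one_le hl1 (one_le_pow₀ (by norm_num))
  have hc0 (k : ℕ) : 0 < c k := by linarith [hc1 k]
  have hcl (k : ℕ) : l ≤ c k := le_mul_of_one_le_right (by linarith) (one_le_pow₀ (by norm_num))
  have hcm {j k : ℕ} (hjk : j < k) : 2 * c j ≤ c k := by
    have : (2 : ℝ) ^ (j + 1) ≤ 2 ^ k := pow_le_pow_right₀ (by norm_num) hjk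
    simp only [hc]
    rw [pow_succ] at this
    nlinarith
  set χ : ℕ → EuclideanSpace ℝ (Fin n) → ℝ := fun k x => radialStep (c k • x) with hχ
  have hχs (k : ℕ) : ContDiff ℝ ∞ (χ k) :=
    (contDiff_radialStep (m := ⊤)).comp (contDiff_const_smul (c k))
  have hnorm (k : ℕ) (x : EuclideanSpace ℝ (Fin n)) : ‖c k • x‖ = c k * ‖x‖ := by
    rw [norm_smul, Real.norm_of_nonneg (hc0 k).le]
  have hdisj (x : EuclideanSpace ℝ (Fin n)) {j k : ℕ} (hjk : j < k) :
      fderiv ℝ (χ j) x = 0 ∨ fderiv ℝ (χ k) x = 0 := by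
    simp only [hχ, fderiv_radialStep_smul]
    by_cases hx : ‖c j • x‖ ^ 2 < 1
    · left
      rw [fderiv_radialStep_of_lt hx, smul_zero]
    · right
      rw [fderiv_radialStep_of_gt, smul_zero]
      rw [not_lt] at hx
      have h1 : 2 * ‖c j • x‖ ≤ ‖c k • x‖ := by
        rw [hnorm, hnorm, ← mul_assoc]
        gcongr
        exact hcm hjk
      nlinarith [norm_nonneg (c j • x)]
  refine ⟨fun x => (N : ℝ)⁻¹ * ∑ k ∈ Finset.range N, χ k x, ?_,
    ⟨(c N)⁻¹, inv_pos.2 (hc0 N), fun x hx => ?_⟩, fun x hx => ?_, ?_⟩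
  · exact contDiff_const.mul (ContDiff.sum fun k _ => hχs k)
  · simp only
    rw [Finset.sum_eq_zero, mul_zero]
    intro k hk
    refine radialStep_of_le ?_
    rw [mem_ball_zero_iff, ← one_div, lt_div_iff₀ (hc0 N)] at hx
    have hkN := hcm (Finset.mem_range.1 hk)
    have : ‖c k • x‖ ≤ 1 := by
      rw [hnorm]
      nlinarith [norm_nonneg x, hc0 k]
    nlinarith [norm_nonneg (c k • x)]
  · have hone (k : ℕ) : χ k x = 1 := by
      refine radialStep_of_ge ?_
      have h2 : 2 ≤ l * ‖x‖ := by
        have h3 : 2 / ρ ≤ l := le_max_left _ _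
        rw [div_le_iff₀ hρ] at h3
        nlinarith
      have h3 : 2 ≤ ‖c k • x‖ := by
        rw [hnorm]
        nlinarith [hcl k, norm_nonneg x]
      nlinarith
    simp only [hone, Finset.sum_const, Finset.card_range, nsmul_eq_mul, mul_one]
    exact inv_mul_cancel₀ hNpos.ne'
  · have hder (x : EuclideanSpace ℝ (Fin n)) :
        fderiv ℝ (fun x => (N : ℝ)⁻¹ * ∑ k ∈ Finset.range N, χ k x) x =
          (N : ℝ)⁻¹ • ∑ k ∈ Finset.range N, fderiv ℝ (χ k) x := by
      have hd (k : ℕ) : DifferentiableAt ℝ (χ k) x := (hχs k).differentiable (by simp) x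
      rw [fderiv_const_mul (DifferentiableAt.fun_sum fun k _ => hd k),
        fderiv_fun_sum fun k _ => hd k]
    have hm (k : ℕ) : Measurable fun x => ‖fderiv ℝ (χ k) x‖ₑ ^ 2 :=
      (((hχs k).continuous_fderiv (by simp)).enorm.measurable).pow_const 2
    have hNe : ‖(N : ℝ)⁻¹‖ₑ = (N : ℝ≥0∞)⁻¹ := by
      rw [enorm_inv hNpos.ne', Real.enorm_natCast]
    calc ∫⁻ x, ‖fderiv ℝ (fun x => (N : ℝ)⁻¹ * ∑ k ∈ Finset.range N, χ k x) x‖ₑ ^ 2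
        ≤ ∫⁻ x, (N : ℝ≥0∞)⁻¹ ^ 2 * ∑ k ∈ Finset.range N, ‖fderiv ℝ (χ k) x‖ₑ ^ 2 := by
          refine lintegral_mono fun x => ?_
          simp only
          rw [hder, enorm_smul, mul_pow, hNe]
          gcongr
          refine enorm_sum_sq_le_of_pairwise _ _ fun i _ j _ hij => ?_
          rcases lt_or_gt_of_ne hij with hij | hij
          · exact hdisj x hij
          · exact (hdisj x hij).symm
      _ = (N : ℝ≥0∞)⁻¹ ^ 2 * ∑ k ∈ Finset.range N, ∫⁻ x, ‖fderiv ℝ (χ k) x‖ₑ ^ 2 := by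
          rw [lintegral_const_mul' _ _ (by simp [hN0]), lintegral_finsetSum _ fun k _ => hm k]
      _ ≤ (N : ℝ≥0∞)⁻¹ ^ 2 * ∑ k ∈ Finset.range N, M := by
          gcongr with k
          exact h _ (hc1 k)
      _ = M / N := by
          rw [Finset.sum_const, Finset.card_range, nsmul_eq_mul, sq, mul_assoc,
            ← mul_assoc _ (N : ℝ≥0∞), ENNReal.inv_mul_cancel (by simpa using hN0) (by simp),
            one_mul, ENNReal.div_eq_inv_mul]
      _ < ε := by
          rcases eq_or_ne ε ⊤ with rfl | hεt
          · exact (ENNReal.div_ne_top hM (by simpa using hN0)).lt_top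
          rw [ENNReal.div_lt_iff (Or.inl (by simpa using hN0)) (Or.inl (by simp))]
          rwa [ENNReal.div_lt_iff (Or.inl hε.ne') (Or.inl hεt), mul_comm] at hN

end Cutoff

/-! ### The perforated domain: eigenvalue bound and extension by zero. -/

section Perforated

variable {n : ℕ} {Ω : Set (EuclideanSpace ℝ (Fin n))} {r : ℝ}

lemma isOpen_perforated (hΩ : IsOpen Ω) (r : ℝ) : IsOpen (perforated Ω r) :=
  hΩ.sdiff Metric.isClosed_closedBall

lemma perforated_subset (Ω : Set (EuclideanSpace ℝ (Fin n))) (r : ℝ) : perforated Ω r ⊆ Ω :=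
  sdiff_subset

lemma isBounded_perforated (hb : Bornology.IsBounded Ω) (r : ℝ) :
    Bornology.IsBounded (perforated Ω r) := hb.subset (perforated_subset Ω r)

lemma surfaceMeasure_frontier_ne_top (hΩ : IsOpen Ω) (hb : Bornology.IsBounded Ω)
    (hlip : HasLipschitzBoundary Ω) : surfaceMeasure (frontier Ω) univ ≠ ⊤ := by
  obtain ⟨C, hC, h⟩ := traceOn_frontier hΩ hb hlip isClosed_empty (empty_subset _)
  have h1 := h (fun _ => 1) contDiff_const
  simp only [enorm_one, one_pow, lintegral_const, one_mul, fderiv_fun_const, Pi.zero_apply,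
    sdiff_empty] at h1
  refine ne_top_of_le_ne_top (ENNReal.mul_ne_top hC ?_) h1
  have : ‖(0 : EuclideanSpace ℝ (Fin n) →L[ℝ] ℝ)‖ₑ = 0 := by rw [← ofReal_norm]; simp
  rw [this]
  simpa using hb.measure_lt_top.ne

lemma integral_inner_self_eq_toReal {α F : Type*} [MeasurableSpace α] {μ : Measure α}
    [NormedAddCommGroup F] [InnerProductSpace ℝ F] {f : α → F} (hf : AEStronglyMeasurable f μ) :
    ∫ x, inner ℝ (f x) (f x) ∂μ = (eLpNorm f 2 μ ^ 2).toReal := by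
  rw [eLpNorm_two_sq, integral_eq_lintegral_of_nonneg_ae]
  · congr 1
    refine lintegral_congr fun x => ?_
    rw [real_inner_self_eq_norm_sq, ENNReal.ofReal_pow (norm_nonneg _), ofReal_norm]
  · exact Eventually.of_forall fun x => real_inner_self_nonneg
  · exact hf.inner hf

lemma dirichletForm_self {v : EuclideanSpace ℝ (Fin n) → ℝ} (hv : MemH1 (perforated Ω r) v) :
    dirichletForm Ω r v v = (eLpNorm (weakGrad (perforated Ω r) v) 2
      (volume.restrict (perforated Ω r)) ^ 2).toReal :=
  integral_inner_self_eq_toReal hv.hasL2WeakGradient.memLp_grad.1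

lemma boundaryForm_self {v : EuclideanSpace ℝ (Fin n) → ℝ}
    (hv : AEStronglyMeasurable (outerTrace Ω r v) (surfaceMeasure (frontier Ω))) :
    boundaryForm Ω r v v =
      (eLpNorm (outerTrace Ω r v) 2 (surfaceMeasure (frontier Ω)) ^ 2).toReal := by
  rw [← integral_inner_self_eq_toReal hv, boundaryForm]
  simp [sq]

lemma sigma1_quotient_nonneg (v : EuclideanSpace ℝ (Fin n) → ℝ) :
    0 ≤ dirichletForm Ω r v v / boundaryForm Ω r v v :=
  div_nonneg (integral_nonneg fun _ => real_inner_self_nonneg)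
    (integral_nonneg fun _ => mul_self_nonneg _)

lemma sigma1_nonneg (Ω : Set (EuclideanSpace ℝ (Fin n))) (r : ℝ) : 0 ≤ sigma1 Ω r := by
  refine Real.sInf_nonneg ?_
  rintro q ⟨v, -, -, rfl⟩
  exact sigma1_quotient_nonneg v

lemma IsTestFunction.memH1Vanishing {U Γ : Set (EuclideanSpace ℝ (Fin n))} (hU : IsOpen U)
    (hb : Bornology.IsBounded U) {φ : EuclideanSpace ℝ (Fin n) → ℝ} (hφ : IsTestFunction φ)
    (h : Disjoint (tsupport φ) Γ) : MemH1Vanishing U Γ φ := by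
  have hw := hasL2WeakGradient_of_contDiff hU.measurableSet hb hφ.contDiff_one
  refine ⟨hw.memH1, fun ε hε => ⟨φ, hφ, h, ?_⟩⟩
  have h0 := (hw.sub hU.measurableSet hb hw).h1Norm_eq hU hb
  rw [sub_self, sub_self] at h0
  rw [sub_self, h0]
  simpa using hε

/-- Test functions equal to `1` on the outer boundary bound the first eigenvalue. -/
lemma sigma1_le (hΩ : IsOpen Ω) (hb : Bornology.IsBounded Ω) (hlip : HasLipschitzBoundary Ω)
    (hr : Metric.closedBall 0 r ⊆ Ω) (hP : perimeter Ω ≠ 0)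
    {v : EuclideanSpace ℝ (Fin n) → ℝ} (hv : IsTestFunction v)
    (hsupp : Disjoint (tsupport v) (Metric.sphere 0 r)) (h1 : ∀ x ∈ frontier Ω, v x = 1) :
    sigma1 Ω r ≤ (∫⁻ x in Ω, ‖fderiv ℝ v x‖ₑ ^ 2).toReal / perimeter Ω := by
  have hU := isOpen_perforated hΩ r
  have hUb := isBounded_perforated hb r
  have htr := traceOn_frontier hΩ hb hlip Metric.isClosed_closedBall hr
  have hfin := surfaceMeasure_frontier_ne_top hΩ hb hlip
  have : IsFiniteMeasure (surfaceMeasure (frontier Ω)) := ⟨hfin.lt_top⟩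
  have hv1 : v =ᵐ[surfaceMeasure (frontier Ω)] fun _ => 1 :=
    ae_restrict_of_forall_mem isClosed_frontier.measurableSet h1
  have hvL : MemLp v 2 (surfaceMeasure (frontier Ω)) := (memLp_const 1).ae_eq hv1.symm
  have hT : IsTrace (perforated Ω r) (frontier Ω) v v := hv.isTrace_self hU hUb hvL
  have hT' := isTrace_trace ⟨v, hT⟩
  have hTv : outerTrace Ω r v =ᵐ[surfaceMeasure (frontier Ω)] fun _ => 1 :=
    (IsTrace.ae_unique htr hU hUb hT' hT).trans hv1
  have hbd : boundaryForm Ω r v v = perimeter Ω := by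
    rw [boundaryForm, integral_congr_ae (g := fun _ => (1 : ℝ))]
    · simp [perimeter, Measure.real]
    · filter_upwards [hTv] with x hx
      simp [hx]
  have hmem : MemH1Hole Ω r v := hv.memH1Vanishing hU hUb hsupp
  have hq : sigma1 Ω r ≤ dirichletForm Ω r v v / boundaryForm Ω r v v := by
    refine csInf_le ⟨0, ?_⟩ ⟨v, hmem, by rwa [hbd], rfl⟩
    rintro q ⟨w, -, -, rfl⟩
    exact sigma1_quotient_nonneg w
  rw [hbd, dirichletForm_self hmem.1] at hq
  have hvw := hasL2WeakGradient_of_contDiff hU.measurableSet hUb hv.contDiff_one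
  rw [eLpNorm_congr_ae (hvw.weakGrad_ae_eq hU hUb), eLpNorm_two_sq] at hq
  simp_rw [enorm_gradient] at hq
  refine hq.trans (div_le_div_of_nonneg_right (ENNReal.toReal_mono ?_ ?_) ENNReal.toReal_nonneg)
  · have h2 := memLp_restrict_of_continuous hΩ.measurableSet hb
      (hv.contDiff_one.continuous_fderiv (by norm_num)) 2
    rw [← eLpNorm_two_sq]
    exact ENNReal.pow_ne_top h2.eLpNorm_ne_top
  · exact lintegral_mono_set (perforated_subset Ω r)

lemma exists_closedBall_subset (hΩ : IsOpen Ω) (h0 : 0 ∈ Ω) :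
    ∃ ρ > 0, Metric.closedBall 0 ρ ⊆ Ω :=
  Metric.nhds_basis_closedBall.mem_iff.1 (hΩ.mem_nhds h0)

/-- Cutoff functions of small energy vanishing near the origin. -/
lemma exists_testFunction_small_energy (hn : 2 ≤ n) (hΩ : IsOpen Ω) (hb : Bornology.IsBounded Ω)
    (h0 : 0 ∈ Ω) {ε : ℝ≥0∞} (hε : 0 < ε) :
    ∃ v : EuclideanSpace ℝ (Fin n) → ℝ, IsTestFunction v ∧
      (∃ s > 0, ∀ x ∈ Metric.ball (0 : EuclideanSpace ℝ (Fin n)) s, v x = 0) ∧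
      (∀ x ∈ frontier Ω, v x = 1) ∧ ∫⁻ x in Ω, ‖fderiv ℝ v x‖ₑ ^ 2 < ε := by
  obtain ⟨ρ, hρ, hρΩ⟩ := exists_closedBall_subset hΩ h0
  obtain ⟨w, hw, ⟨s, hs, hw0⟩, hw1, hwε⟩ := exists_cutoff hn hρ hε
  obtain ⟨R, hR⟩ := hb.closure.subset_closedBall (0 : EuclideanSpace ℝ (Fin n))
  have hR' : closure Ω ⊆ Metric.closedBall 0 (max R 1) :=
    hR.trans (Metric.closedBall_subset_closedBall (le_max_left _ _))
  -- The bump gives compact support without changing `w` on the closure of `Ω`; the maximum with `1`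
  -- keeps its radii positive.
  let f : ContDiffBump (0 : EuclideanSpace ℝ (Fin n)) :=
    ⟨max R 1, max R 1 + 1, by positivity, by linarith⟩
  have hf (x : EuclideanSpace ℝ (Fin n)) (hx : x ∈ closure Ω) : f x = 1 :=
    f.one_of_mem_closedBall (hR' hx)
  refine ⟨fun x => f x * w x, ⟨f.contDiff.mul hw, f.hasCompactSupport.mul_right⟩,
    ⟨s, hs, fun x hx => by simp [hw0 x hx]⟩, fun x hx => ?_, lt_of_le_of_lt ?_ hwε⟩
  · rw [hΩ.frontier_eq] at hx
    have hxρ : ρ ≤ ‖x‖ := by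
      by_contra! hlt
      exact hx.2 (hρΩ (mem_closedBall_zero_iff.2 hlt.le))
    simp [hf x hx.1, hw1 x hxρ]
  · refine (setLIntegral_mono' hΩ.measurableSet fun x hx => ?_).trans
      (setLIntegral_le_lintegral Ω _)
    have : (fun x => f x * w x) =ᶠ[𝓝 x] w := by
      filter_upwards [hΩ.mem_nhds hx] with y hy
      rw [hf y (subset_closure hy), one_mul]
    rw [this.fderiv_eq]

/-- The first Steklov–Dirichlet eigenvalue tends to zero as the hole shrinks. -/
theorem tendsto_sigma1 (hn : 2 ≤ n) (hΩ : IsOpen Ω) (hb : Bornology.IsBounded Ω)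
    (hlip : HasLipschitzBoundary Ω) (h0 : 0 ∈ Ω) :
    Tendsto (fun r : ℝ => sigma1 Ω r) (𝓝[>] 0) (𝓝 0) := by
  -- With a null boundary there are no competitors, and the infimum takes the default value `sInf ∅
  -- = 0`.
  by_cases hP : perimeter Ω = 0
  · have hμ : surfaceMeasure (frontier Ω) = 0 := by
      rw [← Measure.measure_univ_eq_zero]
      exact ((ENNReal.toReal_eq_zero_iff _).1 hP).resolve_right
        (surfaceMeasure_frontier_ne_top hΩ hb hlip)
    have : ∀ r, sigma1 Ω r = 0 := fun r => by
      rw [sigma1]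
      convert Real.sInf_empty
      rw [eq_empty_iff_forall_notMem]
      rintro q ⟨v, -, hv, -⟩
      exact hv (by rw [boundaryForm, hμ, integral_zero_measure])
    simp [this]
  have hPpos : 0 < perimeter Ω := lt_of_le_of_ne ENNReal.toReal_nonneg (Ne.symm hP)
  refine tendsto_order.2 ⟨fun a ha => Eventually.of_forall fun r => ha.trans_le (sigma1_nonneg Ω r),
    fun a ha => ?_⟩
  obtain ⟨v, hv, ⟨s, hs, hv0⟩, hv1, hvε⟩ := exists_testFunction_small_energy hn hΩ hb h0
    (ENNReal.ofReal_pos.2 (mul_pos ha hPpos))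
  obtain ⟨ρ, hρ, hρΩ⟩ := exists_closedBall_subset hΩ h0
  filter_upwards [Ioo_mem_nhdsGT (lt_min hs hρ)] with r hr
  have hrs : r < s := hr.2.trans_le (min_le_left _ _)
  have hrρ : r < ρ := hr.2.trans_le (min_le_right _ _)
  have hsupp : Disjoint (tsupport v) (Metric.sphere 0 r) := by
    rw [Set.disjoint_left]
    intro x hx hxr
    rw [mem_sphere_zero_iff_norm] at hxr
    refine notMem_tsupport_iff_eventuallyEq.2 ?_ hx
    filter_upwards [Metric.isOpen_ball.mem_nhds (mem_ball_zero_iff.2 (hxr.trans_lt hrs))] with y hy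
    exact hv0 y hy
  refine (sigma1_le hΩ hb hlip ((Metric.closedBall_subset_closedBall hrρ.le).trans hρΩ) hP hv hsupp
    hv1).trans_lt ?_
  rw [div_lt_iff₀ hPpos]
  exact (ENNReal.lt_ofReal_iff_toReal_lt hvε.ne_top).1 hvε

/-- Setting a test function to zero in a ball whose boundary sphere misses its support. -/
lemma IsTestFunction.indicator_compl_closedBall {φ : EuclideanSpace ℝ (Fin n) → ℝ}
    (hφ : IsTestFunction φ) (h : Disjoint (tsupport φ) (Metric.sphere 0 r)) :
    IsTestFunction ((Metric.closedBall (0 : EuclideanSpace ℝ (Fin n)) r)ᶜ.indicator φ) ∧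
      ∇ ((Metric.closedBall (0 : EuclideanSpace ℝ (Fin n)) r)ᶜ.indicator φ) =
        (Metric.closedBall (0 : EuclideanSpace ℝ (Fin n)) r)ᶜ.indicator (∇ φ) := by
  set ψ := (Metric.closedBall (0 : EuclideanSpace ℝ (Fin n)) r)ᶜ.indicator φ with hψ
  have hout (x : EuclideanSpace ℝ (Fin n)) (hx : x ∉ Metric.closedBall 0 r) : ψ =ᶠ[𝓝 x] φ := by
    filter_upwards [Metric.isClosed_closedBall.isOpen_compl.mem_nhds hx] with y hy
    exact indicator_of_mem hy φ
  -- On the sphere itself `φ` already vanishes nearby, so the zero and nonzero parts join smoothly.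
  have hin (x : EuclideanSpace ℝ (Fin n)) (hx : x ∈ Metric.closedBall 0 r) :
      ψ =ᶠ[𝓝 x] fun _ => 0 := by
    rcases (mem_closedBall_zero_iff.1 hx).lt_or_eq with hlt | heq
    · filter_upwards [Metric.isOpen_ball.mem_nhds (mem_ball_zero_iff.2 hlt)] with y hy
      exact indicator_of_notMem (not_not.2 (Metric.ball_subset_closedBall hy)) φ
    · have hxs : x ∉ tsupport φ := fun hx' =>
        Set.disjoint_left.1 h hx' (mem_sphere_zero_iff_norm.2 heq)
      filter_upwards [notMem_tsupport_iff_eventuallyEq.1 hxs] with y hy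
      exact indicator_apply_eq_zero.2 fun _ => hy
  refine ⟨⟨?_, ?_⟩, ?_⟩
  · rw [contDiff_iff_contDiffAt]
    intro x
    by_cases hx : x ∈ Metric.closedBall 0 r
    · exact contDiffAt_const.congr_of_eventuallyEq (hin x hx)
    · exact hφ.1.contDiffAt.congr_of_eventuallyEq (hout x hx)
  · refine HasCompactSupport.intro hφ.2 fun x hx => ?_
    exact indicator_apply_eq_zero.2 fun _ => image_eq_zero_of_notMem_tsupport hx
  · ext1 x
    by_cases hx : x ∈ Metric.closedBall 0 r
    · rw [indicator_of_notMem (not_not.2 hx), gradient, (hin x hx).fderiv_eq, fderiv_fun_const,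
        Pi.zero_apply, map_zero]
    · rw [indicator_of_mem hx, gradient, gradient, (hout x hx).fderiv_eq]

/-- Approximation of the extension by zero by test functions. -/
lemma MemH1Hole.exists_testFunction (hΩ : IsOpen Ω) (hb : Bornology.IsBounded Ω)
    {u : EuclideanSpace ℝ (Fin n) → ℝ} (hu : MemH1Hole Ω r u) {ε : ℝ≥0∞} (hε : 0 < ε) :
    ∃ ψ : EuclideanSpace ℝ (Fin n) → ℝ, IsTestFunction ψ ∧
      eLpNorm (zeroExtend Ω r u - ψ) 2 (volume.restrict Ω) < ε ∧
      eLpNorm ((perforated Ω r).indicator (weakGrad (perforated Ω r) u) - ∇ ψ) 2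
        (volume.restrict Ω) < ε ∧
      h1Norm (perforated Ω r) (u - ψ) < ε := by
  have hU := isOpen_perforated hΩ r
  have hUb := isBounded_perforated hb r
  obtain ⟨φ, hφ, hsupp, hlt⟩ := hu.2 ε hε
  obtain ⟨hψ, hgrad⟩ := hφ.indicator_compl_closedBall hsupp
  set K := Metric.closedBall (0 : EuclideanSpace ℝ (Fin n)) r
  have hφw := hu.1.hasL2WeakGradient.sub hU.measurableSet hUb
    (hasL2WeakGradient_of_contDiff hU.measurableSet hUb hφ.contDiff_one)
  have key {F : Type} [NormedAddCommGroup F] (f g : EuclideanSpace ℝ (Fin n) → F) :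
      eLpNorm ((perforated Ω r).indicator f - Kᶜ.indicator g) 2 (volume.restrict Ω) =
        eLpNorm (f - g) 2 (volume.restrict (perforated Ω r)) := by
    have h1 : (perforated Ω r).indicator f - Kᶜ.indicator g =ᵐ[volume.restrict Ω]
        (perforated Ω r).indicator (f - g) := by
      refine ae_restrict_of_forall_mem hΩ.measurableSet fun x hx => ?_
      by_cases hxK : x ∈ K
      · have : x ∉ perforated Ω r := fun h => h.2 hxK
        simp [this, hxK]
      · have : x ∈ perforated Ω r := ⟨hx, hxK⟩
        simp [this, hxK]
    rw [eLpNorm_congr_ae h1, eLpNorm_indicator_eq_eLpNorm_restrict hU.measurableSet,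
      Measure.restrict_restrict hU.measurableSet, inter_eq_left.2 (perforated_subset Ω r)]
  refine ⟨Kᶜ.indicator φ, hψ, ?_, ?_, ?_⟩
  · rw [zeroExtend, key]
    exact (eLpNorm_le_h1Norm _ _).trans_lt hlt
  · rw [hgrad, key, ← eLpNorm_congr_ae (hφw.weakGrad_ae_eq hU hUb)]
    exact (eLpNorm_weakGrad_le_h1Norm _ _).trans_lt hlt
  · have h2 : u - φ =ᵐ[volume.restrict (perforated Ω r)] u - Kᶜ.indicator φ := by
      refine ae_restrict_of_forall_mem hU.measurableSet fun x hx => ?_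
      have : x ∈ Kᶜ := hx.2
      simp only [Pi.sub_apply, indicator_of_mem this]
    rw [(hφw.congr h2 (ae_eq_refl _)).h1Norm_eq hU hUb, ← eLpNorm_congr_ae h2,
      ← hφw.h1Norm_eq hU hUb]
    exact hlt

/-- The extension by zero belongs to `H¹`. -/
lemma MemH1Hole.hasL2WeakGradient_zeroExtend (hΩ : IsOpen Ω) (hb : Bornology.IsBounded Ω)
    {u : EuclideanSpace ℝ (Fin n) → ℝ} (hu : MemH1Hole Ω r u) :
    HasL2WeakGradient Ω (zeroExtend Ω r u)
      ((perforated Ω r).indicator (weakGrad (perforated Ω r) u)) := by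
  have hU := isOpen_perforated hΩ r
  have hr : (volume.restrict Ω).restrict (perforated Ω r) = volume.restrict (perforated Ω r) := by
    rw [Measure.restrict_restrict hU.measurableSet, inter_eq_left.2 (perforated_subset Ω r)]
  refine HasL2WeakGradient.of_approx hΩ.measurableSet hb ?_ ?_ fun ε hε => ?_
  · rw [zeroExtend, memLp_indicator_iff_restrict hU.measurableSet, hr]
    exact hu.1.hasL2WeakGradient.memLp
  · rw [memLp_indicator_iff_restrict hU.measurableSet, hr]
    exact hu.1.hasL2WeakGradient.memLp_grad
  · obtain ⟨ψ, hψ, h1, h2, -⟩ := hu.exists_testFunction hΩ hb hε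
    exact ⟨ψ, ∇ ψ, hasL2WeakGradient_of_contDiff hΩ.measurableSet hb hψ.contDiff_one, h1.le, h2.le⟩

end Perforated

/-! ### Distance of the eigenfunction to the constant. -/

section Convergence

variable {n : ℕ} {Ω : Set (EuclideanSpace ℝ (Fin n))} {r : ℝ}

lemma PoincareOn.eLpNorm_le {U : Set (EuclideanSpace ℝ (Fin n))} (h : PoincareOn Ω U) :
    ∃ C : ℝ≥0∞, C ≠ ⊤ ∧ ∀ φ : EuclideanSpace ℝ (Fin n) → ℝ, ContDiff ℝ 1 φ → ∃ c : ℝ,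
      eLpNorm (φ - fun _ => c) 2 (volume.restrict U) ≤
        C * eLpNorm (∇ φ) 2 (volume.restrict Ω) := by
  obtain ⟨C, hC, h⟩ := h
  refine ⟨C ^ (1 / 2 : ℝ), ENNReal.rpow_ne_top_of_nonneg (by norm_num) hC, fun φ hφ => ?_⟩
  obtain ⟨c, hc⟩ := h φ hφ
  refine ⟨c, lintegral_sq_le_mul_to_eLpNorm ?_⟩
  simp_rw [enorm_gradient]
  exact hc

lemma eLpNorm_two_const {α : Type*} [MeasurableSpace α] (μ : Measure α) [IsFiniteMeasure μ]
    (c : ℝ) : eLpNorm (fun _ : α => c) 2 μ = ‖c‖ₑ * ENNReal.ofReal (√(μ univ).toReal) := by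
  rw [eLpNorm_const' c (by norm_num) (by norm_num), Real.sqrt_eq_rpow,
    ← ENNReal.ofReal_rpow_of_nonneg ENNReal.toReal_nonneg (by norm_num),
    ENNReal.ofReal_toReal (measure_ne_top _ _)]
  simp

/-- The hypotheses are the two triangle inequalities between a function of norm `1` and the constant
`c`, whose boundary norm is `|c| q`. They say `||c| q - 1| ≤ t`. -/
lemma enorm_abs_sub_inv_le {c q : ℝ} (hq : 0 < q) {t : ℝ≥0∞}
    (h1 : 1 ≤ t + ‖c‖ₑ * ENNReal.ofReal q) (h2 : ‖c‖ₑ * ENNReal.ofReal q ≤ t + 1) :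
    ‖|c| - 1 / q‖ₑ ≤ t / ENNReal.ofReal q := by
  induction t with
  | top => simp [ENNReal.top_div_of_ne_top]
  | coe t =>
    rw [← Real.enorm_abs, Real.enorm_of_nonneg (abs_nonneg c),
      ← ENNReal.ofReal_mul (abs_nonneg c)] at h1 h2
    rw [← ENNReal.ofReal_coe_nnreal, ← ENNReal.ofReal_one, ← ENNReal.ofReal_add (by positivity)
      (by positivity), ENNReal.ofReal_le_ofReal_iff (by positivity)] at h1 h2
    rw [← ENNReal.ofReal_coe_nnreal, ← ENNReal.ofReal_div_of_pos hq, Real.enorm_eq_ofReal_abs]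
    refine ENNReal.ofReal_le_ofReal ?_
    rw [le_div_iff₀ hq, ← abs_of_pos hq, ← abs_mul, abs_of_pos hq, sub_mul, one_div,
      inv_mul_cancel₀ hq.ne', abs_le]
    constructor <;> linarith

/-- If no trace existed, `trace` would take its default value `0`, against the normalization. -/
lemma IsNormalizedFirstEigenfunction.isTrace {u : EuclideanSpace ℝ (Fin n) → ℝ}
    (hu : IsNormalizedFirstEigenfunction Ω r u) :
    IsTrace (perforated Ω r) (frontier Ω) u (outerTrace Ω r u) := by
  refine isTrace_trace ?_
  by_contra hne
  have := hu.norm_eq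
  rw [outerTrace, trace, dif_neg hne, eLpNorm_zero] at this
  exact zero_ne_one this

/-- The Dirichlet energy of a normalized first eigenfunction is the eigenvalue. -/
lemma IsNormalizedFirstEigenfunction.eLpNorm_weakGrad_sq {u : EuclideanSpace ℝ (Fin n) → ℝ}
    (hu : IsNormalizedFirstEigenfunction Ω r u) :
    eLpNorm (weakGrad (perforated Ω r) u) 2 (volume.restrict (perforated Ω r)) ^ 2 =
      ENNReal.ofReal (sigma1 Ω r) := by
  have h := hu.eigen.weak_eq u hu.eigen.mem
  rw [boundaryForm_self hu.isTrace.2.1.1, hu.norm_eq, dirichletForm_self hu.eigen.mem.1] at h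
  simp only [one_pow, ENNReal.toReal_one, mul_one] at h
  rw [← h, ENNReal.ofReal_toReal]
  exact ENNReal.pow_ne_top hu.eigen.mem.1.hasL2WeakGradient.memLp_grad.eLpNorm_ne_top

/-- The distance of a normalized first eigenfunction to the constant `P(Ω)^{-1/2}` is controlled by
its Dirichlet energy. -/
lemma exists_h1Norm_zeroExtend_sub_le (hΩ : IsOpen Ω) (hb : Bornology.IsBounded Ω)
    (hc : IsConnected Ω) (hlip : HasLipschitzBoundary Ω) :
    ∃ C : ℝ≥0∞, C ≠ ⊤ ∧ ∀ r : ℝ, Metric.closedBall 0 r ⊆ Ω →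
      ∀ u, IsNormalizedFirstEigenfunction Ω r u → ∀ η : ℝ≥0∞, 0 < η →
      h1Norm Ω (zeroExtend Ω r u - fun _ => 1 / √(perimeter Ω)) ≤
        C * (eLpNorm (weakGrad (perforated Ω r) u) 2 (volume.restrict (perforated Ω r)) + η) := by
  have hfin := surfaceMeasure_frontier_ne_top hΩ hb hlip
  have : IsFiniteMeasure (surfaceMeasure (frontier Ω)) := ⟨hfin.lt_top⟩
  have : IsFiniteMeasure (volume.restrict Ω) := ⟨by simpa using hb.measure_lt_top⟩
  by_cases hP : perimeter Ω = 0
  · refine ⟨0, by simp, fun r hr u hu => ?_⟩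
    have hμ : surfaceMeasure (frontier Ω) = 0 := by
      rw [← Measure.measure_univ_eq_zero]
      exact ((ENNReal.toReal_eq_zero_iff _).1 hP).resolve_right hfin
    have h1 := hu.norm_eq
    rw [hμ, eLpNorm_measure_zero] at h1
    exact absurd h1 zero_ne_one
  have hPpos : 0 < perimeter Ω := lt_of_le_of_ne ENNReal.toReal_nonneg (Ne.symm hP)
  set q := √(perimeter Ω) with hq
  have hqpos : 0 < q := Real.sqrt_pos.2 hPpos
  obtain ⟨Cp, hCp, hpoin⟩ := (poincareOn_self hΩ hb hc hlip).eLpNorm_le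
  -- Removing the empty set gives a trace constant on all of `Ω`, independent of `r`.
  have htr0 := traceOn_frontier hΩ hb hlip isClosed_empty (empty_subset _)
  rw [sdiff_empty] at htr0
  obtain ⟨Ct, hCt, htrace⟩ := htr0.eLpNorm_le hΩ hb
  set m := ENNReal.ofReal (√(volume.restrict Ω univ).toReal)
  set C₁ := 1 + Ct * (Cp + 1) with hC₁
  have hC₁t : C₁ ≠ ⊤ := ENNReal.add_ne_top.2 ⟨by simp, ENNReal.mul_ne_top hCt (by simp [hCp])⟩
  refine ⟨(1 + Cp) + C₁ / ENNReal.ofReal q * m + 1, ?_, fun r hr u hu η hη => ?_⟩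
  · have : C₁ / ENNReal.ofReal q ≠ ⊤ :=
      ENNReal.div_ne_top hC₁t (by simpa using hqpos)
    simp only [ne_eq, ENNReal.add_eq_top, hCp, ENNReal.one_ne_top, or_false, false_or]
    exact ENNReal.mul_ne_top this ENNReal.ofReal_ne_top
  have hU := isOpen_perforated hΩ r
  have hUb := isBounded_perforated hb r
  set a := eLpNorm (weakGrad (perforated Ω r) u) 2 (volume.restrict (perforated Ω r)) with ha
  set T := outerTrace Ω r u
  have hT : IsTrace (perforated Ω r) (frontier Ω) u T := hu.isTrace
  -- `Cr` depends on `r`. Choosing the smooth approximation after it, with error `ε` such that `ε *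
  -- Cr < η`, keeps it out of the final constant.
  obtain ⟨Cr, hCr, htr⟩ :=
    (traceOn_frontier hΩ hb hlip Metric.isClosed_closedBall hr).eLpNorm_trace_sub_le hU hUb
  obtain ⟨ε, hε, hεη⟩ := ENNReal.exists_pos_mul_lt hCr hη.ne'
  obtain ⟨ψ, hψ, h1, h2, h3⟩ := hu.eigen.mem.exists_testFunction hΩ hb (lt_min hε hη)
  have hψ1 := hψ.contDiff_one
  have hext := hu.eigen.mem.hasL2WeakGradient_zeroExtend hΩ hb
  have hψw := hasL2WeakGradient_of_contDiff hΩ.measurableSet hb hψ1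
  set G := (perforated Ω r).indicator (weakGrad (perforated Ω r) u)
  have hGa : eLpNorm G 2 (volume.restrict Ω) = a := by
    rw [eLpNorm_indicator_eq_eLpNorm_restrict hU.measurableSet,
      Measure.restrict_restrict hU.measurableSet, inter_eq_left.2 (perforated_subset Ω r)]
  have hconst (c : ℝ) : HasL2WeakGradient Ω (fun _ => c) 0 := by
    have := hasL2WeakGradient_of_contDiff (u := fun _ => c) hΩ.measurableSet hb contDiff_const
    rwa [show ∇ (fun _ : EuclideanSpace ℝ (Fin n) => c) = 0 by ext1 x; simp [gradient]] at this
  have hgψ : eLpNorm (∇ ψ) 2 (volume.restrict Ω) ≤ a + η := by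
    rw [← sub_sub_cancel G (∇ ψ)]
    refine (eLpNorm_sub_le hext.memLp_grad.1 (hext.memLp_grad.sub hψw.memLp_grad).1
      (by norm_num)).trans ?_
    rw [hGa]
    gcongr
    exact h2.le.trans (min_le_right _ _)
  obtain ⟨c, hc⟩ := hpoin ψ hψ1
  have hψc : eLpNorm (ψ - fun _ => c) 2 (volume.restrict Ω) ≤ Cp * (a + η) :=
    hc.trans (by gcongr)
  have hTψ : eLpNorm (T - ψ) 2 (surfaceMeasure (frontier Ω)) ≤ η := by
    refine (htr u T hT ψ hψ1).trans (le_trans ?_ hεη.le)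
    rw [mul_comm]
    gcongr
    exact h3.le.trans (min_le_left _ _)
  have hψc' : eLpNorm (ψ - fun _ => c) 2 (surfaceMeasure (frontier Ω)) ≤
      Ct * ((Cp + 1) * (a + η)) := by
    refine (htrace (ψ - fun _ => c) (hψ1.sub contDiff_const)).trans (mul_le_mul_right ?_ _)
    refine (h1Norm_le_add Ω _).trans ?_
    have hw := hψw.sub hΩ.measurableSet hb (hconst c)
    rw [sub_zero] at hw
    rw [eLpNorm_congr_ae (hw.weakGrad_ae_eq hΩ hb), add_mul, one_mul]
    exact add_le_add hψc hgψ
  have hψm : AEStronglyMeasurable ψ (surfaceMeasure (frontier Ω)) :=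
    hψ1.continuous.aestronglyMeasurable
  have hTc : eLpNorm (T - fun _ => c) 2 (surfaceMeasure (frontier Ω)) ≤ C₁ * (a + η) := by
    rw [← sub_add_sub_cancel T ψ]
    refine (eLpNorm_add_le (hT.2.1.1.sub hψm) (hψm.sub aestronglyMeasurable_const)
      (by norm_num)).trans ?_
    rw [hC₁, add_mul, one_mul, mul_assoc]
    exact add_le_add (hTψ.trans le_add_self) hψc'
  have hcq : eLpNorm (fun _ => c) 2 (surfaceMeasure (frontier Ω)) = ‖c‖ₑ * ENNReal.ofReal q :=
    eLpNorm_two_const _ c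
  have habs : ‖|c| - 1 / q‖ₑ ≤ C₁ * (a + η) / ENNReal.ofReal q := by
    refine (enorm_abs_sub_inv_le hqpos ?_ ?_).trans (ENNReal.div_le_div_right hTc _)
    · rw [← hcq, ← hu.norm_eq]
      conv_lhs => rw [← sub_add_cancel (outerTrace Ω r u) fun _ => c]
      exact eLpNorm_add_le (hT.2.1.1.sub aestronglyMeasurable_const) aestronglyMeasurable_const
        (by norm_num)
    · rw [← hcq, ← hu.norm_eq, add_comm]
      conv_lhs => rw [← sub_sub_cancel (outerTrace Ω r u) fun _ => c]
      exact eLpNorm_sub_le hT.2.1.1 (hT.2.1.1.sub aestronglyMeasurable_const) (by norm_num)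
  have hnonneg : ∀ᵐ x ∂volume.restrict Ω, 0 ≤ zeroExtend Ω r u x := by
    have hp := hu.pos
    rw [ae_restrict_iff' hU.measurableSet] at hp
    filter_upwards [ae_restrict_of_ae hp] with x hx
    exact indicator_apply_nonneg fun hxU => (hx hxU).le
  -- The boundary norm determines only `|c|`. Since the extension is nonnegative, passing from `c`
  -- to `|c|` does not increase the distance.
  have huc : eLpNorm (zeroExtend Ω r u - fun _ => |c|) 2 (volume.restrict Ω) ≤
      (1 + Cp) * (a + η) := by
    calc eLpNorm (zeroExtend Ω r u - fun _ => |c|) 2 (volume.restrict Ω)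
        ≤ eLpNorm (zeroExtend Ω r u - fun _ => c) 2 (volume.restrict Ω) := by
          refine eLpNorm_mono_ae ?_
          filter_upwards [hnonneg] with x hx
          simp only [Pi.sub_apply, Real.norm_eq_abs]
          conv_lhs => rw [← abs_of_nonneg hx]
          exact abs_abs_sub_abs_le _ _
      _ ≤ eLpNorm (zeroExtend Ω r u - ψ) 2 (volume.restrict Ω) +
            eLpNorm (ψ - fun _ => c) 2 (volume.restrict Ω) := by
          rw [← sub_add_sub_cancel (zeroExtend Ω r u) ψ]
          exact eLpNorm_add_le (hext.memLp.sub hψw.memLp).1 (hψw.memLp.sub (hconst c).memLp).1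
            (by norm_num)
      _ ≤ η + Cp * (a + η) := add_le_add (h1.le.trans (min_le_right _ _)) hψc
      _ ≤ (1 + Cp) * (a + η) := by
          rw [add_mul, one_mul]
          gcongr
          exact le_add_self
  have huq : eLpNorm (zeroExtend Ω r u - fun _ => 1 / q) 2 (volume.restrict Ω) ≤
      (1 + Cp) * (a + η) + C₁ * (a + η) / ENNReal.ofReal q * m := by
    rw [← sub_add_sub_cancel (zeroExtend Ω r u) fun _ => |c|]
    refine (eLpNorm_add_le (hext.memLp.sub (hconst _).memLp).1
      ((hconst _).memLp.sub (hconst _).memLp).1 (by norm_num)).trans (add_le_add huc ?_)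
    refine (eLpNorm_two_const (volume.restrict Ω) (|c| - 1 / q)).trans_le ?_
    gcongr
  have hw := hext.sub hΩ.measurableSet hb (hconst (1 / q))
  rw [sub_zero] at hw
  refine (h1Norm_le_add Ω _).trans ?_
  rw [eLpNorm_congr_ae (hw.weakGrad_ae_eq hΩ hb), hGa]
  refine (add_le_add huq (le_self_add (b := η))).trans (le_of_eq ?_)
  simp only [div_eq_mul_inv]
  ring

end Convergence

end SteklovDirichlet

theorem mainTheorem5 (n : ℕ) (hn : 2 ≤ n) (Ω₀ : Set (EuclideanSpace ℝ (Fin n)))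
    (hopen : IsOpen Ω₀) (hbdd : Bornology.IsBounded Ω₀) (hconn : IsConnected Ω₀)
    (hlip : SteklovDirichlet.HasLipschitzBoundary Ω₀)
    (h0 : (0 : EuclideanSpace ℝ (Fin n)) ∈ Ω₀) :
    (∀ r : ℝ, 0 < r → Metric.closedBall 0 r ⊆ Ω₀ →
      ∀ u : EuclideanSpace ℝ (Fin n) → ℝ,
        SteklovDirichlet.IsNormalizedFirstEigenfunction Ω₀ r u →
        SteklovDirichlet.MemH1 Ω₀ (SteklovDirichlet.zeroExtend Ω₀ r u)) ∧
    (∀ ε : ℝ≥0∞, 0 < ε → ∃ δ : ℝ, 0 < δ ∧ ∀ r : ℝ, 0 < r → r < δ → Metric.closedBall 0 r ⊆ Ω₀ →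
      ∀ u : EuclideanSpace ℝ (Fin n) → ℝ,
        SteklovDirichlet.IsNormalizedFirstEigenfunction Ω₀ r u →
        SteklovDirichlet.h1Norm Ω₀ (SteklovDirichlet.zeroExtend Ω₀ r u -
          fun _ => 1 / Real.sqrt (SteklovDirichlet.perimeter Ω₀)) < ε) ∧
    Tendsto (fun r : ℝ => SteklovDirichlet.sigma1 Ω₀ r) (𝓝[>] 0) (𝓝 0) := by

  refine ⟨fun r _ _ u hu =>
      (hu.eigen.mem.hasL2WeakGradient_zeroExtend hopen hbdd).memH1, fun ε hε => ?_,
    SteklovDirichlet.tendsto_sigma1 hn hopen hbdd hlip h0⟩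
  obtain ⟨C, hC, h⟩ :=
    SteklovDirichlet.exists_h1Norm_zeroExtend_sub_le hopen hbdd hconn hlip
  -- The same `s` bounds the gradient norm, once the eigenvalue is below `s²`, and serves as the
  -- slack `η`; hence the factor `2`.
  obtain ⟨s, hs, hsε⟩ := ENNReal.exists_pos_mul_lt
    (ENNReal.mul_ne_top hC ENNReal.ofNat_ne_top : C * 2 ≠ ⊤) hε.ne'
  have hlim := ENNReal.tendsto_ofReal
    (SteklovDirichlet.tendsto_sigma1 hn hopen hbdd hlip h0)
  rw [ENNReal.ofReal_zero] at hlim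
  have hev := hlim.eventually_lt_const (ENNReal.pow_pos hs 2)
  obtain ⟨δ, hδ, hsub⟩ := mem_nhdsGT_iff_exists_Ioo_subset.1 hev
  refine ⟨δ, hδ, fun r hr hrδ hrΩ u hu => ?_⟩
  have ha := hu.eLpNorm_weakGrad_sq.trans_lt (hsub ⟨hr, hrδ⟩)
  refine ((h r hrΩ u hu s hs).trans ?_).trans_lt hsε
  calc _ ≤ C * (s + s) := by
        gcongr
        exact le_of_not_gt fun hlt => ha.not_ge (pow_le_pow_left' hlt.le 2)
    _ = s * (C * 2) := by ring
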